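/- **Corollary 5 (Generalized Bochner identity).** Let $d\ge 3$, $\alpha=(d-2)/2$, $l\ge 0$ an integer, and let $P$ be a homogeneous polynomial of degree $l$ on $\mathbb R^d$ with complex coefficients. Let $\Delta=\sum_j\partial^2/\partial x_j^2$, $r=|x|$, and for $0\le k\le [l/2]$ put $$h_{l-2k}(P)=\sum_{j=0}^{[l/2]-k}(-1)^j\frac{(\alpha+l-2k)\,\Gamma(\alpha+l-2k-j)}{4^{k+j}\,k!\,j!\,\Gamma(\alpha+l+1-k)}\,r^{2j}\Delta^{k+j}P .$$ For $\nu>-1$ let $J_\nu(t)=\left(\frac t2\right)^{\nu}\sum_{k\ge0}\frac{(-1)^k}{\Gamma(k+1)\Gamma(k+\nu+1)}\left(\frac t2\right)^{2k}$ be the Bessel function of the first kind, $j_\nu(t)=\Gamma(\nu+1)\left(\frac t2\right)^{-\nu}J_\nu(t)$ for $t>0$, $j_\nu(0)=1$, and let $$H_\nu(\varphi)(t)=\frac{2^{-\nu}}{\Gamma(\nu+1)}\int_0^\infty\varphi(s)\,j_\nu(st)\,s^{2\nu+1}\,ds,\qquad t\ge 0,$$ be the Hankel transform. Let $f:[0,\infty)\to\mathbb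 C$ be such that $x\mapsto f(|x|)P(x)$ is integrable on $\mathbb R^d$ (for instance, the restriction of a Schwartz function on $\mathbb R$). Then the $h_{l-2k}(P)$ are the harmonic components of $P$: each $h_{l-2k}(P)$ is a harmonic homogeneous polynomial of degree $l-2k$, and $P=\sum_{k=0}^{[l/2]}r^{2k}h_{l-2k}(P)$. Moreover, for every $y\in\mathbb R^d$, $$(2\pi)^{-d/2}\int_{\mathbb R^d}f(|x|)P(x)e^{i(y|x)}\,dx=i^l\sum_{k=0}^{[l/2]}(-1)^k\,H_{\alpha+l-2k}(s^{2k}f)(|y|)\;h_{l-2k}(P)(y)$$ $$=i^l\sum_{k=0}^{[l/2]}\frac{(-1)^k}{2^k\,k!}\,H_{\alpha+l-k}(f)(|y|)\;(\Delta^kP)(y).$$ Here each Hankel transform whose polynomial factor $h_{l-2k}(P)(y)$, respectively $(\Delta^kP)(y)$, is nonzero is given by an absolutely convergent integral; terms whose polynomial factor vanishes at $y$ are read as $0$. -/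

import Mathlib

open MeasureTheory Set

noncomputable section

namespace GenBochner

/-- The index `α = (d - 2) / 2` attached to `ℝ^d`. -/
def alpha (d : ℕ) : ℝ := ((d : ℝ) - 2) / 2

/-- The value at a point `x ∈ ℝ^d` of a polynomial with complex coefficients. -/
def evalAt {d : ℕ} (P : MvPolynomial (Fin d) ℂ) (x : EuclideanSpace ℝ (Fin d)) : ℂ :=
  MvPolynomial.eval (fun i => ((x i : ℝ) : ℂ)) P

/-- The Laplacian `∑ⱼ ∂²/∂xⱼ²` on polynomials. -/
def lap {d : ℕ} (P : MvPolynomial (Fin d) ℂ) : MvPolynomial (Fin d) ℂ :=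
  ∑ j : Fin d, MvPolynomial.pderiv j (MvPolynomial.pderiv j P)

/-- The polynomial `r² = ∑ⱼ xⱼ²`. -/
def rSq (d : ℕ) : MvPolynomial (Fin d) ℂ := ∑ j : Fin d, MvPolynomial.X j ^ 2

/-- The coefficient
`e^l_j(k) = (-1)^j (α+l-2k) Γ(α+l-2k-j) / (4^(k+j) k! j! Γ(α+l+1-k))`. -/
def harmCoeff (d l k j : ℕ) : ℝ :=
  (-1) ^ j * ((alpha d + l - 2 * k) * Real.Gamma (alpha d + l - 2 * k - j)) /
    (4 ^ (k + j) * (k.factorial : ℝ) * (j.factorial : ℝ) * Real.Gamma (alpha d + l + 1 - k))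

/-- The harmonic component `h_{l-2k}(P) = ∑_{j=0}^{[l/2]-k} e^l_j(k) r^{2j} Δ^{k+j} P`
of a homogeneous polynomial `P` of degree `l` (used for `k ≤ [l/2]`). -/
def harmComp {d : ℕ} (l k : ℕ) (P : MvPolynomial (Fin d) ℂ) : MvPolynomial (Fin d) ℂ :=
  ∑ j ∈ Finset.range (l / 2 - k + 1),
    MvPolynomial.C ((harmCoeff d l k j : ℝ) : ℂ) * rSq d ^ j * lap^[k + j] P

/-- `P = ∑_{k=0}^{[l/2]} r^{2k} h_k`, where `h_k` is a harmonic homogeneous polynomial of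
degree `l - 2k`. -/
structure IsCanonicalDecomposition {d : ℕ} (l : ℕ) (P : MvPolynomial (Fin d) ℂ)
    (h : ℕ → MvPolynomial (Fin d) ℂ) : Prop where
  homogeneous : ∀ k ≤ l / 2, (h k).IsHomogeneous (l - 2 * k)
  harmonic : ∀ k ≤ l / 2, lap (h k) = 0
  sum_eq : P = ∑ k ∈ Finset.range (l / 2 + 1), rSq d ^ k * h k

/-- The Bessel function of the first kind `J_ν(t)`, for real `ν > -1` and `t ≥ 0`. -/
def besselJ (ν t : ℝ) : ℝ :=
  (t / 2) ^ ν * ∑' k : ℕ,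
    (-1) ^ k / (Real.Gamma (k + 1) * Real.Gamma (k + ν + 1)) * (t / 2) ^ (2 * k)

/-- The spherical Bessel function `j_ν(t) = Γ(ν+1) (t/2)^{-ν} J_ν(t)` for `t > 0`, with
`j_ν(0) = 1`, its limit as `t → 0`. -/
def sphBessel (ν t : ℝ) : ℝ :=
  if t = 0 then 1 else Real.Gamma (ν + 1) * (t / 2) ^ (-ν) * besselJ ν t

/-- The integrand `φ(s) j_ν(st) s^{2ν+1}` of the Hankel transform. -/
def hankelIntegrand (ν : ℝ) (φ : ℝ → ℂ) (t s : ℝ) : ℂ :=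
  φ s * (sphBessel ν (s * t) : ℂ) * ((s ^ (2 * ν + 1) : ℝ) : ℂ)

/-- The integral defining `H_ν(φ)(t)` converges absolutely. -/
def HankelConverges (ν : ℝ) (φ : ℝ → ℂ) (t : ℝ) : Prop :=
  IntegrableOn (hankelIntegrand ν φ t) (Ioi 0)

/-- The Hankel transform
`H_ν(φ)(t) = 2^{-ν} / Γ(ν+1) ∫₀^∞ φ(s) j_ν(st) s^{2ν+1} ds`. -/
def hankel (ν : ℝ) (φ : ℝ → ℂ) (t : ℝ) : ℂ :=
  (((2 : ℝ) ^ (-ν) / Real.Gamma (ν + 1) : ℝ) : ℂ) * ∫ s in Ioi (0 : ℝ), hankelIntegrand ν φ t s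

/-- The Fourier transform `(2π)^{-d/2} ∫ e^{i(y|x)} g(x) dx` on `ℝ^d`. -/
def fourierT {d : ℕ} (g : EuclideanSpace ℝ (Fin d) → ℂ) (y : EuclideanSpace ℝ (Fin d)) : ℂ :=
  (((2 * Real.pi) ^ (-(d : ℝ) / 2) : ℝ) : ℂ) *
    ∫ x : EuclideanSpace ℝ (Fin d), Complex.exp (Complex.I * ((inner ℝ y x : ℝ) : ℂ)) * g x

end GenBochner

end

open GenBochner

/-! ### Laplacian on polynomials and the harmonic decomposition. -/

namespace GenBochner

open MvPolynomial

variable {d : ℕ}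

/-! In polar coordinates `x = s ω` the Fourier integral becomes a radial integral of `s ^ (d - 1 +
l) * f s` against the Fourier transform of the measure `P dσ` on the unit sphere, taken at `s • y`.
Everything thus rests on computing that spherical transform, and on justifying the splitting of the
radial integral.

For `P = 1` the exponential is expanded in powers of `⟨y, ω⟩`. The spherical moments come from
evaluating one Gaussian integral both in polar and in Cartesian coordinates, and they sum to `t ^
(-α) J_α(t)` with `t = ‖y‖` (`integral_sphere_cexp`). For general `P` one inducts on the degree:
`∂/∂y_j` brings down the factor `i ω_j`, the function `t ^ (-ν) J_ν(t)` differentiates to the one of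
order `ν + 1`, and `Δ ^ (k + 1) (x_j Q)` splits into exactly the two kinds of terms that the product
rule produces. Euler's identity then reaches every homogeneous `P` (`sphereFourier_eq`). This is the
second formula. On a harmonic polynomial only the term `k = 0` survives, and since `r = 1` on the
sphere, the decomposition of `P` yields the first formula.

The decomposition is algebraic: a two-term recurrence for the coefficients makes each component
harmonic, and a telescoping sum recovers `P`.

For absolute convergence, Fubini shows that `s ^ (d - 1 + l) * f s` is integrable when `P ≠ 0`. The
Bessel bounds still needed follow from the spherical formula itself, applied to `(x_0 + i x_1) ^ m`:
the transform of a finite measure is bounded (`exists_pow_mul_besselSeries_le`). -/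

theorem pderiv_comm (i j : Fin d) (P : MvPolynomial (Fin d) ℂ) :
    pderiv i (pderiv j P) = pderiv j (pderiv i P) := by
  -- A commutator of derivations is a derivation, so it suffices to test it on the variables.
  have h : ⁅pderiv (R := ℂ) i, pderiv (R := ℂ) j⁆ = 0 := by
    refine MvPolynomial.derivation_ext fun n => ?_
    rw [Derivation.commutator_apply]
    simp only [pderiv_X, Derivation.coe_zero, Pi.zero_apply]
    by_cases h1 : n = j <;> by_cases h2 : n = i <;> simp [Pi.single_apply, h1, h2] <;>
      split_ifs <;> simp
  have h2 := congrArg (fun D : Derivation ℂ (MvPolynomial (Fin d) ℂ) (MvPolynomial (Fin d) ℂ) => D P) h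
  simpa [Derivation.commutator_apply, sub_eq_zero] using h2

theorem lap_add (P Q : MvPolynomial (Fin d) ℂ) : lap (P + Q) = lap P + lap Q := by
  simp [lap, Finset.sum_add_distrib]

theorem lap_C_mul (c : ℂ) (P : MvPolynomial (Fin d) ℂ) : lap (C c * P) = C c * lap P := by
  simp [lap, Finset.mul_sum]

theorem lap_zero : lap (0 : MvPolynomial (Fin d) ℂ) = 0 := by simp [lap]

theorem lap_sum {ι : Type*} (s : Finset ι) (F : ι → MvPolynomial (Fin d) ℂ) :
    lap (∑ i ∈ s, F i) = ∑ i ∈ s, lap (F i) := by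
  simp only [lap, map_sum]
  exact Finset.sum_comm

theorem lap_iterate_C_mul (c : ℂ) (P : MvPolynomial (Fin d) ℂ) (k : ℕ) :
    lap^[k] (C c * P) = C c * lap^[k] P := by
  induction k with
  | zero => rfl
  | succ k ih => rw [Function.iterate_succ_apply', ih, lap_C_mul, Function.iterate_succ_apply']

theorem lap_iterate_sum {ι : Type*} (s : Finset ι) (F : ι → MvPolynomial (Fin d) ℂ) (k : ℕ) :
    lap^[k] (∑ i ∈ s, F i) = ∑ i ∈ s, lap^[k] (F i) := by
  induction k with
  | zero => rfl
  | succ k ih => simp only [Function.iterate_succ_apply', ih, lap_sum]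

theorem lap_iterate_zero (k : ℕ) : lap^[k] (0 : MvPolynomial (Fin d) ℂ) = 0 :=
  Function.iterate_fixed lap_zero k

/-- The Leibniz rule for the Laplacian. -/
theorem lap_mul (P Q : MvPolynomial (Fin d) ℂ) :
    lap (P * Q) = lap P * Q + 2 * ∑ j, pderiv j P * pderiv j Q + P * lap Q := by
  simp only [lap, Finset.sum_mul, Finset.mul_sum, ← Finset.sum_add_distrib]
  refine Finset.sum_congr rfl fun j _ => ?_
  simp only [pderiv_mul, map_add]
  ring

theorem lap_X (j : Fin d) : lap (X j : MvPolynomial (Fin d) ℂ) = 0 := by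
  refine Finset.sum_eq_zero fun i _ => ?_
  rw [pderiv_X]
  by_cases h : i = j
  · subst h; simp
  · simp [h]

theorem lap_X_mul (j : Fin d) (Q : MvPolynomial (Fin d) ℂ) :
    lap (X j * Q) = X j * lap Q + 2 * pderiv j Q := by
  rw [lap_mul, lap_X, Finset.sum_eq_single j]
  · simp; ring
  · intro i _ hi
    simp [pderiv_X_of_ne hi.symm]
  · simp

theorem pderiv_lap (j : Fin d) (Q : MvPolynomial (Fin d) ℂ) :
    pderiv j (lap Q) = lap (pderiv j Q) := by
  simp only [lap, map_sum]
  refine Finset.sum_congr rfl fun i _ => ?_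
  rw [pderiv_comm j i, pderiv_comm j i]

/-- The commutator of `Δ` with `x_j` is `2 ∂_j`, which commutes with `Δ`. This identity drives the
induction on degree for the spherical transform. -/
theorem lap_iterate_X_mul (j : Fin d) (Q : MvPolynomial (Fin d) ℂ) (k : ℕ) :
    lap^[k + 1] (X j * Q) =
      X j * lap^[k + 1] Q + C (2 * ((k : ℂ) + 1)) * pderiv j (lap^[k] Q) := by
  induction k with
  | zero =>
    have h2 : (C 2 : MvPolynomial (Fin d) ℂ) = 2 := map_ofNat C 2
    simp [lap_X_mul, h2]
  | succ k ih =>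
    rw [Function.iterate_succ_apply', ih, lap_add, lap_X_mul, lap_C_mul, ← pderiv_lap,
      ← Function.iterate_succ_apply' lap, ← Function.iterate_succ_apply' lap]
    simp only [map_mul, map_add, map_ofNat, map_natCast, map_one]
    push_cast
    ring

theorem isHomogeneous_lap {m : ℕ} {Q : MvPolynomial (Fin d) ℂ} (hQ : Q.IsHomogeneous m) :
    (lap Q).IsHomogeneous (m - 2) :=
  IsHomogeneous.sum _ _ _ fun _ _ => hQ.pderiv.pderiv

theorem isHomogeneous_lap_iterate {m : ℕ} {Q : MvPolynomial (Fin d) ℂ} (hQ : Q.IsHomogeneous m)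
    (k : ℕ) : (lap^[k] Q).IsHomogeneous (m - 2 * k) := by
  induction k with
  | zero => exact hQ
  | succ k ih =>
    rw [Function.iterate_succ_apply']
    exact isHomogeneous_lap ih

theorem lap_eq_zero_of_degree_lt_two {m : ℕ} (hm : m < 2) {Q : MvPolynomial (Fin d) ℂ}
    (hQ : Q.IsHomogeneous m) : lap Q = 0 := by
  refine Finset.sum_eq_zero fun j _ => ?_
  have h : (pderiv j Q).IsHomogeneous 0 := by
    have := hQ.pderiv (i := j)
    rwa [show m - 1 = 0 by omega] at this
  rw [totalDegree_eq_zero_iff_eq_C.1 ((totalDegree_zero_iff_isHomogeneous _).2 h), pderiv_C]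

theorem lap_iterate_eq_zero {m : ℕ} {Q : MvPolynomial (Fin d) ℂ} (hQ : Q.IsHomogeneous m)
    {k : ℕ} (hk : m < 2 * k) : lap^[k] Q = 0 := by
  obtain ⟨n, rfl⟩ : ∃ n, k = n + (m / 2 + 1) := ⟨k - (m / 2 + 1), by omega⟩
  rw [Function.iterate_add_apply, Function.iterate_succ_apply',
    lap_eq_zero_of_degree_lt_two (by omega) (isHomogeneous_lap_iterate hQ (m / 2)),
    lap_iterate_zero]

theorem isHomogeneous_rSq : (rSq d).IsHomogeneous 2 :=
  IsHomogeneous.sum _ _ _ fun j _ => by simpa using (isHomogeneous_X ℂ j).pow 2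

theorem pderiv_rSq (j : Fin d) : pderiv j (rSq d) = 2 * X j := by
  rw [rSq, map_sum, Finset.sum_eq_single j]
  · simp
  · intro i _ hi
    simp [pderiv_X_of_ne hi]
  · simp

theorem lap_rSq_mul {m : ℕ} {Q : MvPolynomial (Fin d) ℂ} (hQ : Q.IsHomogeneous m) :
    lap (rSq d * Q) = C (2 * (d : ℂ) + 4 * m) * Q + rSq d * lap Q := by
  have h1 : lap (rSq d) = C (2 * (d : ℂ)) := by
    have h (j : Fin d) : pderiv j (pderiv j (rSq d)) = C (2 : ℂ) := by
      rw [pderiv_rSq, ← map_ofNat (C : ℂ →+* MvPolynomial (Fin d) ℂ) 2, pderiv_C_mul,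
        pderiv_X_self, mul_one]
    simp only [lap, h, Finset.sum_const, Finset.card_univ, Fintype.card_fin, nsmul_eq_mul,
      map_mul, map_natCast]
    ring
  have h2 : ∑ j, pderiv j (rSq d) * pderiv j Q = C (2 * (m : ℂ)) * Q := by
    have := hQ.sum_X_mul_pderiv
    simp only [pderiv_rSq, mul_assoc, ← Finset.mul_sum, this]
    simp only [map_mul, map_ofNat, map_natCast, nsmul_eq_mul, mul_assoc]
  rw [lap_mul, h1, h2]
  simp only [map_mul, map_add, map_ofNat]
  ring

/-- Each further factor `r²` raises the degree by 2, so the constants `2d + 4(m + 2i)` of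
`lap_rSq_mul` add up over `i ≤ j`. -/
theorem lap_rSq_pow_mul {m : ℕ} {Q : MvPolynomial (Fin d) ℂ} (hQ : Q.IsHomogeneous m) (j : ℕ) :
    lap (rSq d ^ (j + 1) * Q) =
      C (2 * ((j : ℂ) + 1) * (2 * m + d + 2 * j)) * (rSq d ^ j * Q) +
        rSq d ^ (j + 1) * lap Q := by
  induction j with
  | zero =>
    simp only [zero_add, pow_one, lap_rSq_mul hQ]
    simp only [map_mul, map_add, map_ofNat, map_natCast, map_one, Nat.cast_zero, map_zero, pow_zero]
    ring
  | succ j ih =>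
    have h := lap_rSq_mul ((isHomogeneous_rSq (d := d)).pow (j + 1) |>.mul hQ)
    rw [pow_succ', mul_assoc, h, ih]
    simp only [map_mul, map_add, map_ofNat, map_natCast, map_one]
    push_cast
    ring

theorem alpha_pos (hd : 3 ≤ d) : 0 < alpha d := by
  have : (3 : ℝ) ≤ d := by exact_mod_cast hd
  unfold alpha; linarith

/-- The factor on the left is the constant of `lap_rSq_pow_mul` for `Δ ^ (k + j + 1) P`, of degree
`l - 2(k + j + 1)`, rewritten with `d = 2α + 2`. The recurrence makes consecutive terms of `Δ h`
cancel. -/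
theorem harmCoeff_succ (hd : 3 ≤ d) {l k j : ℕ} (h : 2 * (k + (j + 1)) ≤ l) :
    harmCoeff d l k (j + 1) * (4 * (j + 1) * (alpha d + l - 2 * k - (j + 1))) =
      -harmCoeff d l k j := by
  have hα := alpha_pos hd
  have h' : (2 * (k + (j + 1)) : ℝ) ≤ l := by exact_mod_cast h
  have hj : (0 : ℝ) ≤ j := j.cast_nonneg
  have hk : (0 : ℝ) ≤ k := k.cast_nonneg
  have hG : Real.Gamma (alpha d + l - 2 * k - j) = (alpha d + l - 2 * k - (j + 1)) *
      Real.Gamma (alpha d + l - 2 * k - (j + 1)) := by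
    rw [← Real.Gamma_add_one (by linarith)]; congr 1; ring
  have h0 : Real.Gamma (alpha d + l + 1 - k) ≠ 0 := (Real.Gamma_pos_of_pos (by linarith)).ne'
  have hjf : (j.factorial : ℝ) ≠ 0 := by positivity
  have hkf : (k.factorial : ℝ) ≠ 0 := by positivity
  unfold harmCoeff
  rw [hG, Nat.factorial_succ, ← add_assoc, pow_succ, pow_succ]
  push_cast
  field_simp

theorem isHomogeneous_harmComp {l k : ℕ} (hk : k ≤ l / 2) {P : MvPolynomial (Fin d) ℂ}
    (hP : P.IsHomogeneous l) : (harmComp l k P).IsHomogeneous (l - 2 * k) := by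
  refine IsHomogeneous.sum _ _ _ fun j hj => ?_
  have hj' := Finset.mem_range.1 hj
  have h := ((isHomogeneous_C (Fin d) ((harmCoeff d l k j : ℝ) : ℂ)).mul
    ((isHomogeneous_rSq (d := d)).pow j)).mul (isHomogeneous_lap_iterate hP (k + j))
  convert h using 1
  omega

theorem lap_harmComp (hd : 3 ≤ d) {l k : ℕ} (hk : k ≤ l / 2) {P : MvPolynomial (Fin d) ℂ}
    (hP : P.IsHomogeneous l) : lap (harmComp l k P) = 0 := by
  -- The Laplacian of a partial sum telescopes to one boundary term; at the full sum this contains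
  -- `Δ ^ (l / 2 + 1) P`, which vanishes by degree.
  have key : ∀ n, n ≤ l / 2 - k →
      lap (∑ j ∈ Finset.range (n + 1),
        C ((harmCoeff d l k j : ℝ) : ℂ) * rSq d ^ j * lap^[k + j] P) =
      C ((harmCoeff d l k n : ℝ) : ℂ) * rSq d ^ n * lap^[k + n + 1] P := by
    intro n
    induction n with
    | zero => intro _; simp [lap_C_mul, Function.iterate_succ_apply']
    | succ n ih =>
      intro hn
      have hle : 2 * (k + (n + 1)) ≤ l := by omega
      have hcast : ((l - 2 * (k + (n + 1)) : ℕ) : ℝ) = l - 2 * (k + (n + 1)) := by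
        push_cast [Nat.cast_sub hle]; ring
      have hc : (((harmCoeff d l k (n + 1) : ℝ) : ℂ)) *
          (2 * ((n : ℂ) + 1) * (2 * ((l - 2 * (k + (n + 1)) : ℕ) : ℂ) + d + 2 * n)) =
          -((harmCoeff d l k n : ℝ) : ℂ) := by
        rw [← Complex.ofReal_neg, ← harmCoeff_succ hd hle]
        have : ((l - 2 * (k + (n + 1)) : ℕ) : ℂ) = ((l - 2 * (k + (n + 1)) : ℝ) : ℂ) := by
          rw [← hcast]; simp
        rw [this]
        unfold alpha
        push_cast
        ring
      rw [Finset.sum_range_succ, lap_add, ih (by omega), mul_assoc (C _) (rSq d ^ (n + 1)),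
        lap_C_mul, lap_rSq_pow_mul (isHomogeneous_lap_iterate hP _), mul_add, ← mul_assoc (C _),
        ← C_mul, hc, ← Function.iterate_succ_apply' lap]
      simp only [← add_assoc, map_neg]
      ring
  unfold harmComp
  rw [key _ le_rfl, lap_iterate_eq_zero hP (by omega), mul_zero]

/-- The coefficients of the harmonic components telescope. -/
theorem sum_harmCoeff_partial (hd : 3 ≤ d) {l n : ℕ} (hn : 2 * n ≤ l) (K : ℕ) (hK : K ≤ n + 1) :
    (n : ℝ) * 4 ^ n * n.factorial * ∑ k ∈ Finset.range K, harmCoeff d l k (n - k) =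
      -((-1) ^ (n + K) * K * n.choose K *
        (Real.Gamma (alpha d + l - K - n + 1) / Real.Gamma (alpha d + l - K + 1))) := by
  have hα := alpha_pos hd
  have h' : (2 * n : ℝ) ≤ l := by exact_mod_cast hn
  induction K with
  | zero => simp
  | succ K ih =>
    have hKn : K ≤ n := by omega
    obtain ⟨m, rfl⟩ := Nat.exists_eq_add_of_le hKn
    have hm0 : (0 : ℝ) ≤ m := m.cast_nonneg
    have hK0 : (0 : ℝ) ≤ K := K.cast_nonneg
    rw [Finset.sum_range_succ, mul_add, ih (by omega), Nat.add_sub_cancel_left]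
    have hch : (((K + m).choose (K + 1) : ℕ) : ℝ) * (K + 1) = (K + m).choose K * m := by
      have := Nat.choose_succ_right_eq (K + m) K
      rw [Nat.add_sub_cancel_left] at this
      exact_mod_cast this
    have hfac : ((K + m).factorial : ℝ) = (K + m).choose K * K.factorial * m.factorial := by
      have := Nat.choose_mul_factorial_mul_factorial hKn
      rw [Nat.add_sub_cancel_left] at this
      exact_mod_cast this.symm
    unfold harmCoeff
    push_cast at h' ⊢
    set a := alpha d + l with ha
    have hG1 : Real.Gamma (a - K - (K + m) + 1) = (a - K - (K + m)) *
        Real.Gamma (a - 2 * K - m) := by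
      rw [Real.Gamma_add_one (by linarith)]; congr 2; ring
    have hG2 : Real.Gamma (a + 1 - K) = (a - K) * Real.Gamma (a - K) := by
      rw [← Real.Gamma_add_one (by linarith)]; congr 1; ring
    have hG3 : Real.Gamma (a - (K + 1) - (K + m) + 1) = Real.Gamma (a - 2 * K - m) := by
      congr 1; ring
    have hG4 : Real.Gamma (a - (K + 1) + 1) = Real.Gamma (a - K) := by congr 1; ring
    have hG5 : Real.Gamma (a - K + 1) = (a - K) * Real.Gamma (a - K) :=
      Real.Gamma_add_one (by linarith)
    rw [hG1, hG2, hG3, hG4, hG5, hfac]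
    have h0 : Real.Gamma (a - K) ≠ 0 := (Real.Gamma_pos_of_pos (by linarith)).ne'
    have h1 : a - K ≠ 0 := by linarith
    have hs : ((-1 : ℝ)) ^ (K + m + K) = (-1) ^ m := by
      rw [show K + m + K = m + 2 * K by ring, pow_add, pow_mul]; simp
    have hs2 : ((-1 : ℝ)) ^ (K + m + (K + 1)) = -(-1) ^ m := by
      rw [← add_assoc, pow_succ, hs]; ring
    rw [hs, hs2]
    have hmf : (m.factorial : ℝ) ≠ 0 := by positivity
    have hkf : (K.factorial : ℝ) ≠ 0 := by positivity
    have e1 : -(-(-1 : ℝ) ^ m * (K + 1) * ((K + m).choose (K + 1) : ℕ) *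
        (Real.Gamma (a - 2 * K - m) / Real.Gamma (a - K))) =
        (-1) ^ m * ((K + m).choose K * m) * (Real.Gamma (a - 2 * K - m) / Real.Gamma (a - K)) := by
      rw [← hch]; ring
    rw [e1]
    -- With the common binomial and Gamma factors removed, what remains is `(K + m)(a - 2K) - K(a -
    -- 2K - m) = m(a - K)`.
    field_simp
    ring

/-- For `n ≠ 0` the closed form at `K = n + 1` contains `n.choose (n + 1) = 0`. The prefactor `n`
there carries no information at `n = 0`, so that case is direct. -/
theorem sum_harmCoeff (hd : 3 ≤ d) {l n : ℕ} (hn : 2 * n ≤ l) :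
    ∑ k ∈ Finset.range (n + 1), harmCoeff d l k (n - k) = if n = 0 then 1 else 0 := by
  have hα := alpha_pos hd
  split_ifs with h
  · subst h
    have hl : (0 : ℝ) ≤ l := l.cast_nonneg
    have h1 : Real.Gamma (alpha d + l + 1) = (alpha d + l) * Real.Gamma (alpha d + l) :=
      Real.Gamma_add_one (by linarith)
    have h2 := (Real.Gamma_pos_of_pos (show 0 < alpha d + l + 1 by linarith)).ne'
    simp [harmCoeff, ← h1, h2]
  · have := sum_harmCoeff_partial hd hn (n + 1) le_rfl
    rw [Nat.choose_succ_self] at this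
    simp only [Nat.cast_zero, mul_zero, zero_mul, neg_zero, mul_eq_zero] at this
    have h1 : (n : ℝ) ≠ 0 := by exact_mod_cast h
    have h2 : (n.factorial : ℝ) ≠ 0 := by positivity
    simpa [h1, h2] using this

theorem sum_rSq_pow_mul_harmComp (hd : 3 ≤ d) (l : ℕ) (P : MvPolynomial (Fin d) ℂ) :
    ∑ k ∈ Finset.range (l / 2 + 1), rSq d ^ k * harmComp l k P = P := by
  -- Regroup by `n = k + j`: the coefficient of `r ^ (2n) Δ^n P` becomes the sum evaluated in
  -- `sum_harmCoeff`.
  have h1 : ∀ k ∈ Finset.range (l / 2 + 1), rSq d ^ k * harmComp l k P =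
      ∑ n ∈ Finset.range (l / 2 + 1), if k ≤ n then
        C ((harmCoeff d l k (n - k) : ℝ) : ℂ) * (rSq d ^ n * lap^[n] P) else 0 := by
    intro k hk
    have hk' : k ≤ l / 2 := by simpa [Nat.lt_succ_iff] using hk
    rw [← Finset.sum_filter]
    have : (Finset.range (l / 2 + 1)).filter (fun n => k ≤ n) = Finset.Ico k (l / 2 + 1) := by
      ext; simp; omega
    rw [this, Finset.sum_Ico_eq_sum_range, harmComp, Finset.mul_sum,
      show l / 2 + 1 - k = l / 2 - k + 1 by omega]
    refine Finset.sum_congr rfl fun j _ => ?_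
    rw [Nat.add_sub_cancel_left, pow_add]
    ring
  rw [Finset.sum_congr rfl h1, Finset.sum_comm]
  have h2 : ∀ n ∈ Finset.range (l / 2 + 1), (∑ k ∈ Finset.range (l / 2 + 1), if k ≤ n then
        C ((harmCoeff d l k (n - k) : ℝ) : ℂ) * (rSq d ^ n * lap^[n] P) else 0) =
      if n = 0 then P else 0 := by
    intro n hn
    have hn' : n ≤ l / 2 := by simpa [Nat.lt_succ_iff] using hn
    rw [← Finset.sum_filter]
    have : (Finset.range (l / 2 + 1)).filter (fun k => k ≤ n) = Finset.range (n + 1) := by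
      ext; simp; omega
    rw [this, ← Finset.sum_mul, ← map_sum, ← Complex.ofReal_sum,
      sum_harmCoeff hd (by omega)]
    split_ifs with h
    · subst h; simp
    · simp
  rw [Finset.sum_congr rfl h2]
  simp

theorem isCanonicalDecomposition_harmComp (hd : 3 ≤ d) {l : ℕ} {P : MvPolynomial (Fin d) ℂ}
    (hP : P.IsHomogeneous l) : IsCanonicalDecomposition l P (fun k => harmComp l k P) where
  homogeneous _ hk := isHomogeneous_harmComp hk hP
  harmonic _ hk := lap_harmComp hd hk hP
  sum_eq := (sum_rSq_pow_mul_harmComp hd l P).symm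

end GenBochner

/-! ### The Bessel function as an entire function of `t² / 2`. -/

namespace GenBochner

/-- The `n`-th coefficient of the entire function `besselSeries ν`. -/
noncomputable def besselCoeff (ν : ℝ) (n : ℕ) : ℝ :=
  (-1) ^ n * (2 : ℝ) ^ (-ν) / (2 ^ n * n.factorial * Real.Gamma (n + ν + 1))

/-- The entire function with `besselSeries ν (t ^ 2 / 2) = t ^ (-ν) * J_ν(t)`. -/
noncomputable def besselSeries (ν w : ℝ) : ℝ := ∑' n : ℕ, besselCoeff ν n * w ^ n

theorem besselCoeff_succ {ν : ℝ} (hν : 0 < ν) (n : ℕ) :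
    ((n : ℝ) + 1) * besselCoeff ν (n + 1) = -besselCoeff (ν + 1) n := by
  unfold besselCoeff
  rw [Nat.factorial_succ, neg_add, Real.rpow_add two_pos, Real.rpow_neg_one,
    show ((n + 1 : ℕ) : ℝ) + ν + 1 = n + (ν + 1) + 1 by push_cast; ring]
  have h : Real.Gamma (n + (ν + 1) + 1) ≠ 0 := (Real.Gamma_pos_of_pos (by positivity)).ne'
  push_cast
  field_simp
  ring

theorem besselCoeff_succ' {ν : ℝ} (hν : 0 < ν) (n : ℕ) :
    besselCoeff ν (n + 1) = -besselCoeff ν n / (2 * (n + 1) * (n + ν + 1)) := by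
  unfold besselCoeff
  rw [Nat.factorial_succ,
    show ((n + 1 : ℕ) : ℝ) + ν + 1 = n + ν + 1 + 1 by push_cast; ring,
    Real.Gamma_add_one (by positivity)]
  have h : Real.Gamma (n + ν + 1) ≠ 0 := (Real.Gamma_pos_of_pos (by positivity)).ne'
  have h2 : (n : ℝ) + ν + 1 ≠ 0 := by positivity
  push_cast
  field_simp
  ring

/-- Successive coefficients shrink by at least `1 / (n + 1)`, so the exponential series dominates.
-/
theorem abs_besselCoeff_le {ν : ℝ} (hν : 0 < ν) (n : ℕ) :
    |besselCoeff ν n| ≤ |besselCoeff ν 0| / n.factorial := by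
  induction n with
  | zero => simp
  | succ n ih =>
    rw [besselCoeff_succ' hν, abs_div, abs_neg, abs_of_pos (a := 2 * ((n : ℝ) + 1) * (n + ν + 1))
      (by positivity), Nat.factorial_succ]
    rw [div_le_div_iff₀ (by positivity) (by positivity)]
    rw [le_div_iff₀ (by positivity)] at ih
    push_cast
    have h1 : ((n : ℝ) + 1) ≤ 2 * (n + 1) * (n + ν + 1) := by
      have : (0 : ℝ) ≤ n := n.cast_nonneg
      nlinarith
    calc |besselCoeff ν n| * ((n + 1) * n.factorial)
        = (|besselCoeff ν n| * n.factorial) * (n + 1) := by ring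
      _ ≤ _ := mul_le_mul ih h1 (by positivity) (by positivity)

theorem summable_besselSeries {ν : ℝ} (hν : 0 < ν) (w : ℝ) :
    Summable fun n : ℕ => besselCoeff ν n * w ^ n := by
  refine Summable.of_norm_bounded ((Real.summable_pow_div_factorial |w|).mul_left
    |besselCoeff ν 0|) fun n => ?_
  rw [norm_mul, norm_pow, Real.norm_eq_abs, Real.norm_eq_abs, mul_div_left_comm, mul_comm]
  exact mul_le_mul_of_nonneg_left (abs_besselCoeff_le hν n) (by positivity)

/-- Termwise differentiation of the power series. In the variable `w = t² / 2` the classical rule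
`(1/t) d/dt (t ^ (-ν) J_ν) = -t ^ (-ν-1) J_{ν+1}` becomes a plain derivative. -/
theorem hasDerivAt_besselSeries {ν : ℝ} (hν : 0 < ν) (w : ℝ) :
    HasDerivAt (besselSeries ν) (-besselSeries (ν + 1) w) w := by
  set R : ℝ := |w| + 1
  -- Dominates the derivatives on the ball of radius `R`. At `n = 0` the truncated `n - 1` gives a
  -- spurious term, harmless since the derivative there is zero.
  have hsum : Summable fun n : ℕ => |besselCoeff (ν + 1) (n - 1)| * R ^ (n - 1) := by
    rw [← summable_nat_add_iff 1]
    simpa [abs_mul, R, abs_of_nonneg (show (0 : ℝ) ≤ |w| + 1 by positivity)] using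
      (summable_besselSeries (show 0 < ν + 1 by linarith) R).abs
  have h := hasDerivAt_tsum_of_isPreconnected (t := Metric.ball (0 : ℝ) R) (y₀ := 0) (y := w)
    (g := fun n w => besselCoeff ν n * w ^ n)
    (g' := fun n w => besselCoeff ν n * (n * w ^ (n - 1))) hsum Metric.isOpen_ball
    (convex_ball 0 R).isPreconnected
    (fun n x _ => (hasDerivAt_pow n x).const_mul _)
    (fun n x hx => ?_) (by simp [R]; positivity) (summable_besselSeries hν 0) (by simp [R])
  · have e : -besselSeries (ν + 1) w = ∑' n : ℕ, besselCoeff ν n * (n * w ^ (n - 1)) := by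
      have hs : Summable fun n : ℕ => besselCoeff ν n * (n * w ^ (n - 1)) := by
        rw [← summable_nat_add_iff 1]
        refine (summable_besselSeries (show 0 < ν + 1 by linarith) w).neg.congr fun n => ?_
        rw [← neg_mul, ← besselCoeff_succ hν]
        push_cast [Nat.add_sub_cancel]
        ring
      rw [hs.tsum_eq_zero_add]
      simp only [Nat.cast_zero, zero_mul, mul_zero, zero_add, besselSeries, ← tsum_neg]
      refine tsum_congr fun n => ?_
      rw [← neg_mul, ← besselCoeff_succ hν]
      push_cast [Nat.add_sub_cancel]
      ring
    rw [e]
    exact h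
  · rcases n with _ | n
    · simp
    · simp only [Nat.add_sub_cancel]
      rw [show besselCoeff ν (n + 1) * (((n + 1 : ℕ) : ℝ) * x ^ n) =
        -besselCoeff (ν + 1) n * x ^ n by rw [← besselCoeff_succ hν]; push_cast; ring]
      rw [norm_mul, norm_neg, norm_pow, Real.norm_eq_abs]
      have : ‖x‖ ≤ R := by simpa using (Metric.mem_ball.1 hx).le
      gcongr

theorem continuous_besselSeries {ν : ℝ} (hν : 0 < ν) : Continuous (besselSeries ν) :=
  continuous_iff_continuousAt.2 fun w => (hasDerivAt_besselSeries hν w).continuousAt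

theorem sphBessel_eq_besselSeries {ν : ℝ} (hν : 0 < ν) {t : ℝ} (ht : 0 ≤ t) :
    (2 : ℝ) ^ (-ν) / Real.Gamma (ν + 1) * sphBessel ν t = besselSeries ν (t ^ 2 / 2) := by
  have hG : Real.Gamma (ν + 1) ≠ 0 := (Real.Gamma_pos_of_pos (by linarith)).ne'
  unfold sphBessel
  split_ifs with h
  · subst h
    unfold besselSeries
    rw [tsum_eq_single 0 (by intro n hn; simp [hn])]
    simp [besselCoeff]
  · have ht' : 0 < t / 2 := by positivity
    unfold besselJ
    rw [show ∀ S, Real.Gamma (ν + 1) * (t / 2) ^ (-ν) * ((t / 2) ^ ν * S) =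
      Real.Gamma (ν + 1) * ((t / 2) ^ (-ν) * (t / 2) ^ ν) * S by intro S; ring,
      ← Real.rpow_add ht', neg_add_cancel, Real.rpow_zero, mul_one, ← mul_assoc,
      div_mul_cancel₀ _ hG, ← tsum_mul_left]
    refine tsum_congr fun n => ?_
    rw [besselCoeff, Real.Gamma_nat_eq_factorial, pow_mul]
    simp only [div_pow, ← pow_mul]
    rw [show (2 : ℝ) ^ (2 * n) = 2 ^ n * 2 ^ n by rw [two_mul, pow_add]]
    field_simp

end GenBochner

/-! ### Polar coordinates, Gaussian moments and the transform of the sphere. -/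

namespace GenBochner

open Metric

section Polar

variable {E : Type*} [NormedAddCommGroup E] [NormedSpace ℝ E] [MeasurableSpace E] [BorelSpace E]
  [FiniteDimensional ℝ E] [Nontrivial E] (μ : Measure E) [μ.IsAddHaarMeasure]
  {F : Type*} [NormedAddCommGroup F]

theorem integrable_polar_iff (G : E → F) :
    Integrable G μ ↔ Integrable (fun p : sphere (0 : E) 1 × Ioi (0 : ℝ) => G (p.2.1 • p.1.1))
      (μ.toSphere.prod (.volumeIoiPow (Module.finrank ℝ E - 1))) := by
  rw [← μ.measurePreserving_homeomorphUnitSphereProd.integrable_comp_emb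
    (Homeomorph.measurableEmbedding _)]
  conv_lhs => rw [← restrict_compl_singleton (μ := μ) 0, ← IntegrableOn,
    integrableOn_iff_comap_subtypeVal (by measurability)]
  refine integrable_congr (.of_forall fun x => ?_)
  have hx : ‖x.1‖ ≠ 0 := norm_ne_zero_iff.2 x.2
  simp [smul_smul, hx]

theorem integrable_volumeIoiPow_iff [NormedSpace ℝ F] (n : ℕ) (φ : ℝ → F) :
    Integrable (fun r : Ioi (0 : ℝ) => φ r) (.volumeIoiPow n) ↔
      IntegrableOn (fun s => s ^ n • φ s) (Ioi 0) := by
  rw [integrableOn_iff_comap_subtypeVal measurableSet_Ioi, Measure.volumeIoiPow,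
    integrable_withDensity_iff_integrable_smul' (by fun_prop) (by simp)]
  refine integrable_congr (.of_forall ?_)
  rintro ⟨x, hx : 0 < x⟩
  simp (disch := positivity) [ENNReal.toReal_ofReal]

variable [NormedSpace ℝ F]

theorem integral_polar (G : E → F) :
    ∫ x, G x ∂μ = ∫ p : sphere (0 : E) 1 × Ioi (0 : ℝ), G (p.2.1 • p.1.1)
      ∂(μ.toSphere.prod (.volumeIoiPow (Module.finrank ℝ E - 1))) := by
  rw [← μ.measurePreserving_homeomorphUnitSphereProd.integral_comp
    (Homeomorph.measurableEmbedding _)]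
  conv_lhs => rw [← restrict_compl_singleton (μ := μ) 0,
    ← integral_subtype_comap (measurableSet_singleton _).compl]
  refine integral_congr_ae (.of_forall fun x => ?_)
  have hx : ‖x.1‖ ≠ 0 := norm_ne_zero_iff.2 x.2
  simp [smul_smul, hx]

theorem integral_volumeIoiPow (n : ℕ) (φ : ℝ → F) :
    ∫ r : Ioi (0 : ℝ), φ r ∂(.volumeIoiPow n) = ∫ s in Ioi (0 : ℝ), s ^ n • φ s := by
  simp only [Measure.volumeIoiPow, ENNReal.ofReal]
  rw [integral_withDensity_eq_integral_smul,
    integral_subtype_comap measurableSet_Ioi fun a ↦ Real.toNNReal (a ^ n) • φ a,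
    setIntegral_congr_fun measurableSet_Ioi fun x hx ↦ ?_]
  · rw [NNReal.smul_def, Real.coe_toNNReal _ (pow_nonneg hx.out.le _)]
  · exact (measurable_subtype_coe.pow_const _).real_toNNReal

end Polar

theorem integral_pow_mul_exp_neg_sq_Ioi (n : ℕ) :
    ∫ s in Ioi (0 : ℝ), s ^ n * Real.exp (-(s ^ 2 / 2)) =
      2 ^ (((n : ℝ) + 1) / 2) / 2 * Real.Gamma ((n + 1) / 2) := by
  have hn : (0 : ℝ) ≤ n := n.cast_nonneg
  have h := integral_rpow_mul_exp_neg_mul_rpow (p := 2) (q := n) (b := 1 / 2) two_pos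
    (by linarith) (by norm_num)
  rw [one_div, Real.inv_rpow (by norm_num), ← Real.rpow_neg (by norm_num)] at h
  rw [show ((n : ℝ) + 1) / 2 = -(-(n + 1) / 2) by ring]
  rw [show Real.Gamma (-(-((n : ℝ) + 1) / 2)) = Real.Gamma ((n + 1) / 2) by congr 1; ring]
  rw [div_eq_mul_inv (_ ^ _), ← h]
  refine setIntegral_congr_fun measurableSet_Ioi fun s _ => ?_
  simp only [Real.rpow_natCast, Real.rpow_ofNat]
  congr 2
  ring

theorem integral_pow_mul_exp_neg_sq (m : ℕ) :
    (∫ s : ℝ, s ^ (2 * m) * Real.exp (-(s ^ 2 / 2))) * m.factorial * 2 ^ m =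
      (2 * m).factorial * √(2 * Real.pi) := by
  have h1 : ∫ s : ℝ, s ^ (2 * m) * Real.exp (-(s ^ 2 / 2)) =
      2 * ∫ s in Ioi (0 : ℝ), s ^ (2 * m) * Real.exp (-(s ^ 2 / 2)) := by
    rw [← integral_comp_abs (f := fun s : ℝ => s ^ (2 * m) * Real.exp (-(s ^ 2 / 2)))]
    simp [pow_mul]
  -- Legendre duplication at `m + 1/2` turns `Γ(m + 1/2) * m!` into `(2m)!`.
  have h2 := Real.Gamma_mul_Gamma_add_half ((m : ℝ) + 1 / 2)
  rw [show (m : ℝ) + 1 / 2 + 1 / 2 = m + 1 by ring, Real.Gamma_nat_eq_factorial,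
    show 2 * ((m : ℝ) + 1 / 2) = ((2 * m : ℕ) : ℝ) + 1 by push_cast; ring,
    Real.Gamma_nat_eq_factorial,
    show (1 : ℝ) - (((2 * m : ℕ) : ℝ) + 1) = -((2 * m : ℕ) : ℝ) by ring,
    Real.rpow_neg two_pos.le, Real.rpow_natCast] at h2
  rw [h1, integral_pow_mul_exp_neg_sq_Ioi,
    show (((2 * m : ℕ) : ℝ) + 1) / 2 = m + 1 / 2 by push_cast; ring,
    Real.rpow_add two_pos, Real.rpow_natCast, ← Real.sqrt_eq_rpow,
    Real.sqrt_mul two_pos.le]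
  calc _ = 2 ^ m * √2 * 2 ^ m * (Real.Gamma (m + 1 / 2) * m.factorial) := by ring
    _ = _ := by
      rw [h2, two_mul m, pow_add]
      field_simp

variable {d : ℕ}

theorem exists_orthonormalBasis_eq_norm_smul (y : EuclideanSpace ℝ (Fin d)) (i : Fin d) :
    ∃ b : OrthonormalBasis (Fin d) ℝ (EuclideanSpace ℝ (Fin d)), y = ‖y‖ • b i := by
  by_cases hy : y = 0
  · exact ⟨EuclideanSpace.basisFun _ _, by simp [hy]⟩
  · have hy' : ‖y‖ ≠ 0 := norm_ne_zero_iff.2 hy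
    have hv : Orthonormal ℝ (({i} : Set (Fin d)).domRestrict fun _ => ‖y‖⁻¹ • y) := by
      refine ⟨fun j => ?_, fun j k hjk => ?_⟩
      · simp [norm_smul, hy']
      · exact absurd (Subsingleton.elim j k) hjk
    obtain ⟨b, hb⟩ := hv.exists_orthonormalBasis_extension_of_card_eq (by simp)
    exact ⟨b, by rw [hb i rfl, smul_smul, mul_inv_cancel₀ hy', one_smul]⟩

/-- Rotating `y` onto a coordinate axis makes the integrand a product of functions of one variable;
the other `d - 1` factors are each `√(2π)`. -/
theorem integral_inner_pow_mul_gaussian [NeZero d] (y : EuclideanSpace ℝ (Fin d)) (n : ℕ) :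
    ∫ x : EuclideanSpace ℝ (Fin d), inner ℝ y x ^ n * Real.exp (-(‖x‖ ^ 2 / 2)) =
      ‖y‖ ^ n * (∫ s : ℝ, s ^ n * Real.exp (-(s ^ 2 / 2))) * √(2 * Real.pi) ^ (d - 1) := by
  obtain ⟨b, hb⟩ := exists_orthonormalBasis_eq_norm_smul y 0
  have hinner (z : EuclideanSpace ℝ (Fin d)) : inner ℝ y (b.repr.symm z) = ‖y‖ * z 0 := by
    conv_lhs => rw [hb]
    rw [real_inner_smul_left, ← b.repr_apply_apply, LinearIsometryEquiv.apply_symm_apply]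
  rw [← b.measurePreserving_repr_symm.integral_comp
      b.repr.symm.toHomeomorph.measurableEmbedding,
    ← (PiLp.volume_preserving_toLp (Fin d)).integral_comp
      (MeasurableEquiv.toLp 2 (Fin d → ℝ)).measurableEmbedding]
  simp only [hinner, LinearIsometryEquiv.norm_map, EuclideanSpace.real_norm_sq_eq]
  have e (z : Fin d → ℝ) : (‖y‖ * z 0) ^ n * Real.exp (-((∑ i, z i ^ 2) / 2)) =
      ‖y‖ ^ n * ∏ i, ((if i = 0 then z i ^ n else 1) * Real.exp (-(z i ^ 2 / 2))) := by
    rw [Finset.prod_mul_distrib, ← Real.exp_sum, Finset.prod_ite_eq' Finset.univ (0 : Fin d),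
      if_pos (Finset.mem_univ _), mul_pow, Finset.sum_div, Finset.sum_neg_distrib, mul_assoc]
  simp only [e]
  rw [integral_const_mul, mul_assoc, integral_fintype_prod_volume_eq_prod
    (fun i s => (if i = (0 : Fin d) then s ^ n else 1) * Real.exp (-(s ^ 2 / 2))),
    ← Finset.mul_prod_erase _ _ (Finset.mem_univ (0 : Fin d))]
  congr 1
  congr 1
  · have h0 := integral_pow_mul_exp_neg_sq 0
    simp only [mul_zero, pow_zero, one_mul, Nat.factorial_zero, Nat.cast_one, mul_one] at h0
    rw [Finset.prod_congr rfl fun i hi => ?_, Finset.prod_const, Finset.card_erase_of_mem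
      (Finset.mem_univ _), Finset.card_univ, Fintype.card_fin]
    simp only [if_neg (Finset.ne_of_mem_erase hi), one_mul, h0]

/-- The same Gaussian integral in polar coordinates: its radial factor is positive, so the spherical
moment can be solved for. -/
theorem integral_sphere_inner_pow_mul [NeZero d] (y : EuclideanSpace ℝ (Fin d)) (n : ℕ) :
    (∫ ω, inner ℝ y ω.1 ^ n ∂(volume : Measure (EuclideanSpace ℝ (Fin d))).toSphere) *
      (∫ s in Ioi (0 : ℝ), s ^ (d - 1 + n) * Real.exp (-(s ^ 2 / 2))) =
      ‖y‖ ^ n * (∫ s : ℝ, s ^ n * Real.exp (-(s ^ 2 / 2))) * √(2 * Real.pi) ^ (d - 1) := by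
  have : Nonempty (Fin d) := ⟨0⟩
  rw [← integral_inner_pow_mul_gaussian,
    integral_polar (volume : Measure (EuclideanSpace ℝ (Fin d)))]
  have e (p : sphere (0 : EuclideanSpace ℝ (Fin d)) 1 × Ioi (0 : ℝ)) :
      inner ℝ y (p.2.1 • p.1.1) ^ n * Real.exp (-(‖p.2.1 • p.1.1‖ ^ 2 / 2)) =
      inner ℝ y p.1.1 ^ n * (p.2.1 ^ n * Real.exp (-(p.2.1 ^ 2 / 2))) := by
    have hp : ‖p.1.1‖ = 1 := by simp
    rw [norm_smul, hp, real_inner_smul_right, mul_one, Real.norm_eq_abs, sq_abs]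
    ring
  simp only [e]
  rw [integral_prod_mul (fun ω : sphere (0 : EuclideanSpace ℝ (Fin d)) 1 => inner ℝ y ω.1 ^ n)
    (fun r : Ioi (0 : ℝ) => r.1 ^ n * Real.exp (-(r.1 ^ 2 / 2))),
    integral_volumeIoiPow _ (fun s => s ^ n * Real.exp (-(s ^ 2 / 2))), finrank_euclideanSpace_fin]
  simp only [pow_add, smul_eq_mul, mul_assoc]

theorem integral_pow_mul_exp_neg_sq_Ioi_pos (n : ℕ) :
    0 < ∫ s in Ioi (0 : ℝ), s ^ n * Real.exp (-(s ^ 2 / 2)) := by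
  rw [integral_pow_mul_exp_neg_sq_Ioi]
  have := Real.Gamma_pos_of_pos (show (0 : ℝ) < (n + 1) / 2 by positivity)
  positivity

theorem integral_sphere_inner_pow_odd [NeZero d] (y : EuclideanSpace ℝ (Fin d)) (m : ℕ) :
    ∫ ω, inner ℝ y ω.1 ^ (2 * m + 1)
      ∂(volume : Measure (EuclideanSpace ℝ (Fin d))).toSphere = 0 := by
  have h := integral_sphere_inner_pow_mul y (2 * m + 1)
  have h0 : ∫ s : ℝ, s ^ (2 * m + 1) * Real.exp (-(s ^ 2 / 2)) = 0 := by
    have := integral_neg_eq_self (fun s : ℝ => s ^ (2 * m + 1) * Real.exp (-(s ^ 2 / 2))) volume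
    simp only [Odd.neg_pow (⟨m, rfl⟩ : Odd (2 * m + 1)), neg_sq, neg_mul, integral_neg] at this
    linarith
  rw [h0, mul_zero, zero_mul, mul_eq_zero] at h
  exact h.resolve_right (integral_pow_mul_exp_neg_sq_Ioi_pos _).ne'

theorem integral_sphere_inner_pow_even (hd : 3 ≤ d) (y : EuclideanSpace ℝ (Fin d)) (m : ℕ) :
    (-1) ^ m / ((2 * m).factorial : ℝ) * ∫ ω, inner ℝ y ω.1 ^ (2 * m)
      ∂(volume : Measure (EuclideanSpace ℝ (Fin d))).toSphere =
    (2 * Real.pi) ^ ((d : ℝ) / 2) * (besselCoeff (alpha d) m * (‖y‖ ^ 2 / 2) ^ m) := by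
  have : NeZero d := ⟨by omega⟩
  have hα := alpha_pos hd
  have h := integral_sphere_inner_pow_mul y (2 * m)
  have h1 := integral_pow_mul_exp_neg_sq m
  -- The radial integral supplies the `Γ(m + α + 1)` of the Bessel coefficient.
  rw [integral_pow_mul_exp_neg_sq_Ioi, show (((d - 1 + 2 * m : ℕ) : ℝ) + 1) / 2 =
    m + alpha d + 1 by push_cast [Nat.cast_sub (show 1 ≤ d by omega), alpha]; ring,
    add_assoc, add_comm (m : ℝ), Real.rpow_add two_pos, Real.rpow_natCast,
    Real.rpow_add two_pos, Real.rpow_one, add_assoc, add_comm 1, ← add_assoc, add_comm _ (m : ℝ)] at h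
  have hG := Real.Gamma_pos_of_pos (show 0 < (m : ℝ) + alpha d + 1 by positivity)
  have h2 : (2 * Real.pi) ^ ((d : ℝ) / 2) = √(2 * Real.pi) ^ (d - 1) * √(2 * Real.pi) := by
    rw [← pow_succ, Nat.sub_add_cancel (by omega), Real.sqrt_eq_rpow, ← Real.rpow_natCast,
      ← Real.rpow_mul (by positivity)]
    congr 1; ring
  have h2a : (0 : ℝ) < 2 ^ (alpha d) := by positivity
  rw [besselCoeff, h2, Real.rpow_neg two_pos.le]
  set M := ∫ ω, inner ℝ y ω.1 ^ (2 * m)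
      ∂(volume : Measure (EuclideanSpace ℝ (Fin d))).toSphere
  set G := ∫ s : ℝ, s ^ (2 * m) * Real.exp (-(s ^ 2 / 2))
  set S := √(2 * Real.pi)
  set A := (2 : ℝ) ^ (alpha d)
  have hM : M = ‖y‖ ^ (2 * m) * G * S ^ (d - 1) /
      (A * 2 ^ m * Real.Gamma (m + alpha d + 1)) := by
    rw [eq_div_iff (by positivity), ← h]; ring
  have hGv : G = (2 * m).factorial * S / (m.factorial * 2 ^ m) := by
    rw [eq_div_iff (by positivity), ← h1]; ring
  rw [hM, hGv, div_pow, ← pow_mul]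
  field_simp

theorem integrable_sphere_of_continuous {G : sphere (0 : EuclideanSpace ℝ (Fin d)) 1 → ℂ}
    (hG : Continuous G) :
    Integrable G (volume : Measure (EuclideanSpace ℝ (Fin d))).toSphere :=
  hG.integrable_of_hasCompactSupport (HasCompactSupport.of_compactSpace G)

/-- The Fourier transform of the surface measure of the unit sphere. -/
theorem integral_sphere_cexp (hd : 3 ≤ d) (y : EuclideanSpace ℝ (Fin d)) :
    ∫ ω, Complex.exp (Complex.I * ((inner ℝ y ω.1 : ℝ) : ℂ))
      ∂(volume : Measure (EuclideanSpace ℝ (Fin d))).toSphere =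
    (((2 * Real.pi) ^ ((d : ℝ) / 2) * besselSeries (alpha d) (‖y‖ ^ 2 / 2) : ℝ) : ℂ) := by
  have : NeZero d := ⟨by omega⟩
  have hsum := hasSum_integral_of_dominated_convergence
    (μ := (volume : Measure (EuclideanSpace ℝ (Fin d))).toSphere)
    (F := fun (n : ℕ) ω => (Complex.I * ((inner ℝ y ω.1 : ℝ) : ℂ)) ^ n / (n.factorial : ℂ))
    (f := fun ω => Complex.exp (Complex.I * ((inner ℝ y ω.1 : ℝ) : ℂ)))
    (fun n _ => ‖y‖ ^ n / n.factorial)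
    (fun n => (Continuous.aestronglyMeasurable (by fun_prop)))
    (fun n => .of_forall fun ω => ?_)
    (.of_forall fun _ => Real.summable_pow_div_factorial ‖y‖)
    (integrable_const _)
    (.of_forall fun ω => by
      rw [Complex.exp_eq_exp_ℂ]; exact NormedSpace.expSeries_div_hasSum_exp _)
  · refine hsum.unique ?_
    -- Split the target as even part plus odd part; the odd moments contribute 0.
    rw [← add_zero (((_ : ℝ) : ℂ))]
    have hi (n : ℕ) : ∫ ω, (Complex.I * ((inner ℝ y ω.1 : ℝ) : ℂ)) ^ n / (n.factorial : ℂ)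
        ∂(volume : Measure (EuclideanSpace ℝ (Fin d))).toSphere =
        Complex.I ^ n / n.factorial * ((∫ ω, inner ℝ y ω.1 ^ n
          ∂(volume : Measure (EuclideanSpace ℝ (Fin d))).toSphere : ℝ) : ℂ) := by
      rw [← integral_complex_ofReal, ← integral_const_mul]
      refine integral_congr_ae (.of_forall fun ω => ?_)
      push_cast
      ring
    refine HasSum.even_add_odd ?_ ?_
    · have := ((summable_besselSeries (alpha_pos hd) (‖y‖ ^ 2 / 2)).hasSum.mul_left
        ((2 * Real.pi) ^ ((d : ℝ) / 2)))
      have e (m : ℕ) : Complex.I ^ (2 * m) / ((2 * m).factorial : ℂ) *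
          ((∫ ω, inner ℝ y ω.1 ^ (2 * m)
            ∂(volume : Measure (EuclideanSpace ℝ (Fin d))).toSphere : ℝ) : ℂ) =
          (((2 * Real.pi) ^ ((d : ℝ) / 2) *
            (besselCoeff (alpha d) m * (‖y‖ ^ 2 / 2) ^ m) : ℝ) : ℂ) := by
        rw [← integral_sphere_inner_pow_even hd, pow_mul, Complex.I_sq]
        simp only [Complex.ofReal_mul, Complex.ofReal_div, Complex.ofReal_pow, Complex.ofReal_neg,
          Complex.ofReal_one, Complex.ofReal_natCast]
      simp only [hi, e]
      exact Complex.hasSum_ofReal.2 this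
    · simp only [hi, integral_sphere_inner_pow_odd]
      simp
  · rw [norm_div, norm_pow, norm_mul, Complex.norm_I, one_mul, Complex.norm_real,
      Complex.norm_natCast]
    have := norm_inner_le_norm (𝕜 := ℝ) y ω.1
    have hω : ‖ω.1‖ = 1 := by simp
    rw [hω, mul_one] at this
    gcongr

end GenBochner

/-! ### The Fourier transform of a polynomial measure on the sphere. -/

namespace GenBochner

open Metric MvPolynomial

variable {d : ℕ}

theorem continuous_evalAt (P : MvPolynomial (Fin d) ℂ) : Continuous (evalAt P) := by
  unfold evalAt
  exact (MvPolynomial.continuous_eval P).comp (by fun_prop)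

theorem evalAt_mul (P Q : MvPolynomial (Fin d) ℂ) (x : EuclideanSpace ℝ (Fin d)) :
    evalAt (P * Q) x = evalAt P x * evalAt Q x := map_mul _ _ _

theorem evalAt_add (P Q : MvPolynomial (Fin d) ℂ) (x : EuclideanSpace ℝ (Fin d)) :
    evalAt (P + Q) x = evalAt P x + evalAt Q x := map_add _ _ _

theorem evalAt_sum {ι : Type*} (s : Finset ι) (F : ι → MvPolynomial (Fin d) ℂ)
    (x : EuclideanSpace ℝ (Fin d)) : evalAt (∑ i ∈ s, F i) x = ∑ i ∈ s, evalAt (F i) x :=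
  map_sum _ _ _

theorem evalAt_zero (x : EuclideanSpace ℝ (Fin d)) :
    evalAt (0 : MvPolynomial (Fin d) ℂ) x = 0 := map_zero _

theorem evalAt_C (c : ℂ) (x : EuclideanSpace ℝ (Fin d)) : evalAt (C c) x = c := eval_C _

theorem evalAt_X (j : Fin d) (x : EuclideanSpace ℝ (Fin d)) : evalAt (X j) x = (x j : ℂ) :=
  eval_X _

theorem evalAt_smul {m : ℕ} {P : MvPolynomial (Fin d) ℂ} (hP : P.IsHomogeneous m) (s : ℝ)
    (x : EuclideanSpace ℝ (Fin d)) : evalAt P (s • x) = (s : ℂ) ^ m * evalAt P x := by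
  unfold evalAt
  rw [eval_eq', eval_eq', Finset.mul_sum]
  refine Finset.sum_congr rfl fun a ha => ?_
  have hm : ∑ i, a i = m := by
    rw [← Finsupp.degree_eq_sum, Finsupp.degree_eq_weight_one]
    exact hP (mem_support_iff.1 ha)
  simp only [PiLp.smul_apply, smul_eq_mul, Complex.ofReal_mul, mul_pow, Finset.prod_mul_distrib,
    Finset.prod_pow_eq_pow_sum, hm]
  ring

theorem evalAt_rSq (x : EuclideanSpace ℝ (Fin d)) : evalAt (rSq d) x = ((‖x‖ ^ 2 : ℝ) : ℂ) := by
  rw [EuclideanSpace.real_norm_sq_eq, rSq, evalAt_sum]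
  push_cast
  exact Finset.sum_congr rfl fun j _ => by rw [pow_two, evalAt_mul, evalAt_X, pow_two]

theorem hasDerivAt_evalAt (P : MvPolynomial (Fin d) ℂ) (y : EuclideanSpace ℝ (Fin d))
    (j : Fin d) : HasDerivAt (fun t : ℝ => evalAt P (y + t • EuclideanSpace.single j 1))
      (evalAt (pderiv j P) y) 0 := by
  induction P using MvPolynomial.induction_on with
  | C a => simpa [evalAt_C, evalAt_zero] using hasDerivAt_const (0 : ℝ) a
  | add p q hp hq => simpa only [map_add, evalAt_add] using hp.fun_add hq
  | mul_X p i hp =>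
    have hX : HasDerivAt (fun t : ℝ => evalAt (X i) (y + t • EuclideanSpace.single j 1))
        (evalAt (pderiv j (X i : MvPolynomial (Fin d) ℂ)) y) 0 := by
      simp only [evalAt_X]
      by_cases h : i = j
      · subst h
        simp only [pderiv_X_self]
        have : HasDerivAt (fun t : ℝ => ((y i + t : ℝ) : ℂ)) ((1 : ℝ) : ℂ) 0 :=
          ((hasDerivAt_id (0 : ℝ)).const_add (y i)).ofReal_comp
        simpa [evalAt] using this
      · simpa [pderiv_X_of_ne h, evalAt_zero, h] using hasDerivAt_const (0 : ℝ) ((y i : ℝ) : ℂ)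
    have := hp.fun_mul hX
    simp only [zero_smul, add_zero] at this
    simpa only [pderiv_mul, evalAt_add, evalAt_mul] using this

theorem hasDerivAt_norm_sq_div_two (y : EuclideanSpace ℝ (Fin d)) (j : Fin d) :
    HasDerivAt (fun t : ℝ => ‖y + t • EuclideanSpace.single j (1 : ℝ)‖ ^ 2 / 2) (y j) 0 := by
  have h1 : HasDerivAt (fun t : ℝ => y + t • EuclideanSpace.single j (1 : ℝ))
      (EuclideanSpace.single j (1 : ℝ)) 0 := by
    simpa using ((hasDerivAt_id (0 : ℝ)).smul_const (EuclideanSpace.single j (1 : ℝ))).const_add y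
  have h2 := h1.norm_sq.div_const 2
  simpa [EuclideanSpace.inner_single_right] using h2

/-- The Fourier transform of the measure `P dσ` on the unit sphere. -/
noncomputable def sphereFourier (P : MvPolynomial (Fin d) ℂ) (y : EuclideanSpace ℝ (Fin d)) : ℂ :=
  ∫ ω, Complex.exp (Complex.I * ((inner ℝ y ω.1 : ℝ) : ℂ)) * evalAt P ω.1
    ∂(volume : Measure (EuclideanSpace ℝ (Fin d))).toSphere

theorem continuous_sphereFourier_integrand (P : MvPolynomial (Fin d) ℂ)
    (y : EuclideanSpace ℝ (Fin d)) :
    Continuous fun ω : sphere (0 : EuclideanSpace ℝ (Fin d)) 1 =>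
      Complex.exp (Complex.I * ((inner ℝ y ω.1 : ℝ) : ℂ)) * evalAt P ω.1 := by
  have := (continuous_evalAt P).comp (continuous_subtype_val (p := (· ∈ sphere (0 : _) 1)))
  exact Continuous.mul (by fun_prop) this

theorem sphereFourier_sum {ι : Type*} (s : Finset ι) (F : ι → MvPolynomial (Fin d) ℂ)
    (y : EuclideanSpace ℝ (Fin d)) :
    sphereFourier (∑ i ∈ s, F i) y = ∑ i ∈ s, sphereFourier (F i) y := by
  unfold sphereFourier
  rw [← integral_finsetSum _ fun i _ =>
    integrable_sphere_of_continuous (continuous_sphereFourier_integrand (F i) y)]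
  simp only [evalAt_sum, Finset.mul_sum]

theorem sphereFourier_C_mul (c : ℂ) (P : MvPolynomial (Fin d) ℂ)
    (y : EuclideanSpace ℝ (Fin d)) : sphereFourier (C c * P) y = c * sphereFourier P y := by
  unfold sphereFourier
  rw [← integral_const_mul]
  simp only [evalAt_mul, evalAt_C]
  exact integral_congr_ae (.of_forall fun ω => by ring)

theorem sphereFourier_rSq_pow_mul (k : ℕ) (P : MvPolynomial (Fin d) ℂ)
    (y : EuclideanSpace ℝ (Fin d)) : sphereFourier (rSq d ^ k * P) y = sphereFourier P y := by
  refine integral_congr_ae (.of_forall fun ω => ?_)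
  have h1 : ‖ω.1‖ = 1 := by simp
  have h2 : evalAt (rSq d ^ k) ω.1 = 1 := by
    rw [evalAt, map_pow, ← evalAt, evalAt_rSq, h1]
    simp
  simp only [evalAt_mul, h2, one_mul]

theorem norm_cexp_I_mul_ofReal (r : ℝ) : ‖Complex.exp (Complex.I * (r : ℂ))‖ = 1 := by
  rw [mul_comm, Complex.norm_exp_ofReal_mul_I]

/-- Differentiation under the integral: the exponential is unimodular, so `‖ω_j P(ω)‖` dominates for
every `t`. -/
theorem hasDerivAt_sphereFourier (P : MvPolynomial (Fin d) ℂ) (y : EuclideanSpace ℝ (Fin d))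
    (j : Fin d) :
    HasDerivAt (fun t : ℝ => sphereFourier P (y + t • EuclideanSpace.single j 1))
      (Complex.I * sphereFourier (X j * P) y) 0 := by
  have hc (Q : MvPolynomial (Fin d) ℂ) :
      Continuous fun ω : sphere (0 : EuclideanSpace ℝ (Fin d)) 1 => evalAt Q ω.1 :=
    (continuous_evalAt Q).comp continuous_subtype_val
  have h := hasDerivAt_integral_of_dominated_loc_of_deriv_le
    (μ := (volume : Measure (EuclideanSpace ℝ (Fin d))).toSphere)
    (F := fun (t : ℝ) ω => Complex.exp (Complex.I *
      ((inner ℝ (y + t • EuclideanSpace.single j (1 : ℝ)) ω.1 : ℝ) : ℂ)) * evalAt P ω.1)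
    (F' := fun (t : ℝ) ω => Complex.I * (Complex.exp (Complex.I *
      ((inner ℝ (y + t • EuclideanSpace.single j (1 : ℝ)) ω.1 : ℝ) : ℂ)) *
        evalAt (X j * P) ω.1)) (x₀ := 0) (s := univ)
    (bound := fun ω => ‖evalAt (X j * P) ω.1‖) Filter.univ_mem
    (.of_forall fun t => (continuous_sphereFourier_integrand P _).aestronglyMeasurable)
    (integrable_sphere_of_continuous (continuous_sphereFourier_integrand P _))
    ((continuous_sphereFourier_integrand (X j * P) _).const_mul _).aestronglyMeasurable
    (.of_forall fun ω t _ => ?_)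
    (integrable_sphere_of_continuous (hc _)).norm
    (.of_forall fun ω t _ => ?_)
  · have h2 := h.2
    simp only [zero_smul, add_zero, integral_const_mul] at h2
    exact h2
  · rw [norm_mul, norm_mul, Complex.norm_I, norm_cexp_I_mul_ofReal, one_mul, one_mul]
  · have h1 : HasDerivAt (fun t : ℝ => Complex.I *
        ((inner ℝ (y + t • EuclideanSpace.single j (1 : ℝ)) ω.1 : ℝ) : ℂ))
        (Complex.I * ((ω.1 j : ℝ) : ℂ)) t := by
      have e (t : ℝ) : inner ℝ (y + t • EuclideanSpace.single j (1 : ℝ)) ω.1 =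
          inner ℝ y ω.1 + t * ω.1 j := by
        rw [inner_add_left, real_inner_smul_left, EuclideanSpace.inner_single_left]
        simp
      simp only [e]
      refine HasDerivAt.const_mul _ (HasDerivAt.ofReal_comp ?_)
      simpa using ((hasDerivAt_id t).mul_const (ω.1 j)).const_add (inner ℝ y ω.1)
    refine (h1.cexp.mul_const (evalAt P ω.1)).congr_deriv ?_
    rw [evalAt_mul, evalAt_X]
    ring

/-- The constant `(2π)^{d/2}`. -/
noncomputable def fourierConst (d : ℕ) : ℂ := (((2 * Real.pi) ^ ((d : ℝ) / 2) : ℝ) : ℂ)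

/-- The summand `(-1)^k / (2^k k!) * besselSeries (α + l - k) (|y|² / 2) * (Δ^k P)(y)`. -/
noncomputable def hobsonTerm (l : ℕ) (P : MvPolynomial (Fin d) ℂ)
    (y : EuclideanSpace ℝ (Fin d)) (k : ℕ) : ℂ :=
  (-1) ^ k / (2 ^ k * (k.factorial : ℂ)) *
    ((besselSeries (alpha d + l - k) (‖y‖ ^ 2 / 2) : ℝ) : ℂ) * evalAt (lap^[k] P) y

theorem hasDerivAt_hobsonTerm (hd : 3 ≤ d) {l k : ℕ} (hk : k ≤ l) (P : MvPolynomial (Fin d) ℂ)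
    (y : EuclideanSpace ℝ (Fin d)) (j : Fin d) :
    HasDerivAt (fun t : ℝ => hobsonTerm l P (y + t • EuclideanSpace.single j 1) k)
      ((-1) ^ k / (2 ^ k * (k.factorial : ℂ)) *
        (-((besselSeries (alpha d + (l + 1 : ℕ) - k) (‖y‖ ^ 2 / 2) : ℝ) : ℂ) * (y j : ℂ) *
            evalAt (lap^[k] P) y +
          ((besselSeries (alpha d + l - k) (‖y‖ ^ 2 / 2) : ℝ) : ℂ) *
            evalAt (pderiv j (lap^[k] P)) y)) 0 := by
  have hα := alpha_pos hd
  have hkl : (k : ℝ) ≤ l := by exact_mod_cast hk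
  have h1 := (hasDerivAt_besselSeries (show 0 < alpha d + l - k by linarith)
    (‖y + (0 : ℝ) • EuclideanSpace.single j (1 : ℝ)‖ ^ 2 / 2)).comp (0 : ℝ)
    (hasDerivAt_norm_sq_div_two y j)
  have h2 := (h1.ofReal_comp.fun_mul (hasDerivAt_evalAt (lap^[k] P) y j)).const_mul
    ((-1 : ℂ) ^ k / (2 ^ k * (k.factorial : ℂ)))
  simp only [zero_smul, add_zero, Function.comp_def] at h2
  unfold hobsonTerm
  simp only [mul_assoc] at h2 ⊢
  refine h2.congr_deriv ?_
  rw [show alpha d + (l + 1 : ℕ) - k = alpha d + l - k + 1 by push_cast; ring]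
  push_cast
  ring

/-- By `lap_iterate_X_mul`, the term `k + 1` on the right splits into the first summand at `k + 1`
and the second at `k`, the factor `2(k + 1)` being absorbed by `2 ^ (k + 1) (k + 1)!`. Summing up to
`l` rather than `l / 2` avoids the parity of `l`; the extra terms vanish. -/
theorem sum_hobsonTerm_deriv {l : ℕ} {P : MvPolynomial (Fin d) ℂ}
    (hP : P.IsHomogeneous l) (y : EuclideanSpace ℝ (Fin d)) (j : Fin d) :
    ∑ k ∈ Finset.range (l + 1), ((-1) ^ k / (2 ^ k * (k.factorial : ℂ)) *
        (-((besselSeries (alpha d + (l + 1 : ℕ) - k) (‖y‖ ^ 2 / 2) : ℝ) : ℂ) * (y j : ℂ) *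
            evalAt (lap^[k] P) y +
          ((besselSeries (alpha d + l - k) (‖y‖ ^ 2 / 2) : ℝ) : ℂ) *
            evalAt (pderiv j (lap^[k] P)) y)) =
      -∑ k ∈ Finset.range (l + 1 + 1), hobsonTerm (l + 1) (X j * P) y k := by
  have hlast : lap^[l + 1] P = 0 := lap_iterate_eq_zero hP (by omega)
  simp only [mul_add, Finset.sum_add_distrib]
  rw [Finset.sum_range_succ' (fun k => hobsonTerm (l + 1) (X j * P) y k)]
  have e1 (k : ℕ) : hobsonTerm (l + 1) (X j * P) y (k + 1) =
      (-1) ^ (k + 1) / (2 ^ (k + 1) * ((k + 1).factorial : ℂ)) *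
      (((besselSeries (alpha d + (l + 1 : ℕ) - (k + 1 : ℕ)) (‖y‖ ^ 2 / 2) : ℝ) : ℂ) * (y j : ℂ) *
            evalAt (lap^[k + 1] P) y) -
      (-1) ^ k / (2 ^ k * (k.factorial : ℂ)) *
        (((besselSeries (alpha d + l - k) (‖y‖ ^ 2 / 2) : ℝ) : ℂ) *
            evalAt (pderiv j (lap^[k] P)) y) := by
    rw [hobsonTerm, lap_iterate_X_mul, evalAt_add, evalAt_mul, evalAt_mul, evalAt_X, evalAt_C,
      show alpha d + (l + 1 : ℕ) - (k + 1 : ℕ) = alpha d + l - k by push_cast; ring,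
      Nat.factorial_succ]
    have h1 : (k : ℂ) + 1 ≠ 0 := by exact_mod_cast k.succ_ne_zero
    have h2 : (k.factorial : ℂ) ≠ 0 := by exact_mod_cast k.factorial_ne_zero
    push_cast
    field_simp
    ring
  simp only [e1, Finset.sum_sub_distrib]
  have e2 := Finset.sum_range_succ' (fun k => (-1) ^ k / (2 ^ k * (k.factorial : ℂ)) *
      (((besselSeries (alpha d + (l + 1 : ℕ) - k) (‖y‖ ^ 2 / 2) : ℝ) : ℂ) * (y j : ℂ) *
            evalAt (lap^[k] P) y)) (l + 1)
  rw [Finset.sum_range_succ, hlast, evalAt_zero, mul_zero, mul_zero, add_zero] at e2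
  have e3 : hobsonTerm (l + 1) (X j * P) y 0 =
      (-1) ^ 0 / (2 ^ 0 * ((0 : ℕ).factorial : ℂ)) *
      (((besselSeries (alpha d + (l + 1 : ℕ) - (0 : ℕ)) (‖y‖ ^ 2 / 2) : ℝ) : ℂ) * (y j : ℂ) *
            evalAt (lap^[0] P) y) := by
    simp only [hobsonTerm, Function.iterate_zero, id_eq, evalAt_mul, evalAt_X]
    ring
  rw [e3]
  simp only [neg_mul, mul_neg, Finset.sum_neg_distrib]
  rw [e2]
  ring

/-- The Fourier transform of `P dσ` on the unit sphere, for `P` homogeneous of degree `l`. -/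
theorem sphereFourier_eq (hd : 3 ≤ d) (l : ℕ) (P : MvPolynomial (Fin d) ℂ)
    (hP : P.IsHomogeneous l) (y : EuclideanSpace ℝ (Fin d)) :
    sphereFourier P y =
      fourierConst d * (Complex.I ^ l * ∑ k ∈ Finset.range (l + 1), hobsonTerm l P y k) := by
  induction l generalizing P y with
  | zero =>
    obtain ⟨c, rfl⟩ : ∃ c, P = C c :=
      ⟨_, totalDegree_eq_zero_iff_eq_C.1 ((totalDegree_zero_iff_isHomogeneous _).2 hP)⟩
    have := integral_sphere_cexp hd y
    simp only [sphereFourier, evalAt_C, hobsonTerm, integral_mul_const, this, fourierConst]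
    simp [evalAt_C]
    ring
  | succ l ih =>
    have hX (Q : MvPolynomial (Fin d) ℂ) (hQ : Q.IsHomogeneous l) (j : Fin d) :
        sphereFourier (X j * Q) y = fourierConst d * (Complex.I ^ (l + 1) *
          ∑ k ∈ Finset.range (l + 1 + 1), hobsonTerm (l + 1) (X j * Q) y k) := by
      have h1 := hasDerivAt_sphereFourier Q y j
      simp only [ih Q hQ] at h1
      have h2 := ((HasDerivAt.fun_sum fun k (hk : k ∈ Finset.range (l + 1)) =>
        hasDerivAt_hobsonTerm hd (Nat.lt_succ_iff.1 (Finset.mem_range.1 hk)) Q y j).const_mul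
        (Complex.I ^ l)).const_mul (fourierConst d)
      have h3 := h1.unique h2
      rw [sum_hobsonTerm_deriv hQ] at h3
      have h4 := congrArg (fun z => -Complex.I * z) h3
      simp only [← mul_assoc, neg_mul, Complex.I_mul_I, neg_neg, one_mul] at h4
      rw [h4]
      ring
    have hl : ((l : ℂ) + 1) ≠ 0 := by exact_mod_cast l.succ_ne_zero
    -- Euler's identity reduces degree `l + 1` to products `x_j Q` with `Q` of degree `l`.
    have hPe : P = C ((l : ℂ) + 1)⁻¹ * ∑ j, X j * pderiv j P := by
      rw [hP.sum_X_mul_pderiv, nsmul_eq_mul, ← mul_assoc, ← map_natCast C, ← C_mul]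
      push_cast
      rw [inv_mul_cancel₀ hl, C_1, one_mul]
    have hlin : ∀ k, hobsonTerm (l + 1) P y k =
        ((l : ℂ) + 1)⁻¹ * ∑ j, hobsonTerm (l + 1) (X j * pderiv j P) y k := by
      intro k
      conv_lhs => rw [hPe]
      simp only [hobsonTerm, lap_iterate_C_mul, lap_iterate_sum, evalAt_mul, evalAt_C, evalAt_sum,
        Finset.mul_sum]
      exact Finset.sum_congr rfl fun j _ => by ring
    simp only [hlin, ← Finset.mul_sum]
    rw [Finset.sum_comm]
    conv_lhs => rw [hPe]
    rw [sphereFourier_C_mul, sphereFourier_sum, Finset.sum_congr rfl fun j _ =>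
      hX (pderiv j P) (by simpa using hP.pderiv) j, ← Finset.mul_sum, ← Finset.mul_sum]
    ring

theorem sphereFourier_of_harmonic (hd : 3 ≤ d) {m : ℕ} {P : MvPolynomial (Fin d) ℂ}
    (hP : P.IsHomogeneous m) (hh : lap P = 0) (y : EuclideanSpace ℝ (Fin d)) :
    sphereFourier P y = fourierConst d * (Complex.I ^ m *
      (((besselSeries (alpha d + m) (‖y‖ ^ 2 / 2) : ℝ) : ℂ) * evalAt P y)) := by
  rw [sphereFourier_eq hd m P hP, Finset.sum_range_succ', Finset.sum_eq_zero]
  · simp [hobsonTerm]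
  · intro k _
    rw [hobsonTerm, Function.iterate_succ_apply, hh, lap_iterate_zero, evalAt_zero, mul_zero]

end GenBochner

/-! ### Bessel bounds, convergence and radial integration. -/

namespace GenBochner

open Metric MvPolynomial

variable {d : ℕ}

/-- If `L` is harmonic with isotropic gradient (for the bilinear form, without conjugation), both
terms of the chain rule for `Δ(L ^ m)` vanish. -/
theorem lap_pow_eq_zero {L : MvPolynomial (Fin d) ℂ} (h1 : lap L = 0)
    (h2 : ∑ j, pderiv j L * pderiv j L = 0) (m : ℕ) : lap (L ^ m) = 0 := by
  induction m with
  | zero => simp [lap]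
  | succ m ih =>
    have h3 : ∑ j, pderiv j L * pderiv j (L ^ m) =
        (m * L ^ (m - 1)) * ∑ j, pderiv j L * pderiv j L := by
      rw [Finset.mul_sum]
      exact Finset.sum_congr rfl fun j _ => by rw [pderiv_pow]; ring
    rw [pow_succ', lap_mul, h1, ih, h3, h2]
    simp

/-- There is a harmonic homogeneous polynomial of degree `m` with value `t ^ m` at a point of
norm `t`. -/
theorem exists_harmonic (hd : 3 ≤ d) (m : ℕ) : ∃ h : MvPolynomial (Fin d) ℂ,
    h.IsHomogeneous m ∧ lap h = 0 ∧
      ∀ t : ℝ, 0 ≤ t → ∃ y : EuclideanSpace ℝ (Fin d), ‖y‖ = t ∧ evalAt h y = (t : ℂ) ^ m := by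
  let i : Fin d := ⟨0, by omega⟩
  let j : Fin d := ⟨1, by omega⟩
  have hij : i ≠ j := by simp [i, j]
  refine ⟨(X i + C Complex.I * X j) ^ m, ?_, lap_pow_eq_zero ?_ ?_ m, fun t ht => ?_⟩
  · have : (X i + C Complex.I * X j : MvPolynomial (Fin d) ℂ).IsHomogeneous 1 :=
      (isHomogeneous_X ℂ i).add (isHomogeneous_C_mul_X Complex.I j)
    simpa using this.pow m
  · rw [lap_add, lap_C_mul, lap_X, lap_X]; simp
  · have e (k : Fin d) : pderiv k (X i + C Complex.I * X j : MvPolynomial (Fin d) ℂ) *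
        pderiv k (X i + C Complex.I * X j) =
        (if k = i then 1 else 0) - (if k = j then 1 else 0) := by
      simp only [map_add, pderiv_C_mul]
      by_cases h1 : k = i
      · subst h1
        simp [hij, pderiv_X_of_ne hij.symm]
      · by_cases h2 : k = j
        · subst h2
          simp [pderiv_X_of_ne hij, hij.symm, ← C_mul]
        · simp [h1, h2, pderiv_X_of_ne (Ne.symm h1), pderiv_X_of_ne (Ne.symm h2)]
    simp only [e, Finset.sum_sub_distrib, Finset.sum_ite_eq', Finset.mem_univ, if_true, sub_self]
  · refine ⟨EuclideanSpace.single i t, by simp [abs_of_nonneg ht], ?_⟩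
    simp [evalAt, hij.symm]

theorem fourierConst_ne_zero (d : ℕ) : fourierConst d ≠ 0 := by
  unfold fourierConst
  exact_mod_cast (Real.rpow_pos_of_pos (by positivity) _).ne'

/-- For the harmonic `h` of `exists_harmonic`, the left side is `‖sphereFourier h y‖` up to the
constant, and this is at most the integral of `‖h‖` over the sphere. No asymptotics of Bessel
functions enter. -/
theorem exists_pow_mul_besselSeries_le (hd : 3 ≤ d) (m : ℕ) :
    ∃ B, ∀ t : ℝ, 0 ≤ t → t ^ m * |besselSeries (alpha d + m) (t ^ 2 / 2)| ≤ B := by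
  obtain ⟨h, h1, h2, h3⟩ := exists_harmonic hd m
  refine ⟨(∫ ω, ‖evalAt h ω.1‖ ∂(volume : Measure (EuclideanSpace ℝ (Fin d))).toSphere) /
    ‖fourierConst d‖, fun t ht => ?_⟩
  obtain ⟨y, rfl, hy⟩ := h3 t ht
  have hb : ‖sphereFourier h y‖ ≤
      ∫ ω, ‖evalAt h ω.1‖ ∂(volume : Measure (EuclideanSpace ℝ (Fin d))).toSphere := by
    refine (norm_integral_le_integral_norm _).trans_eq ?_
    simp only [norm_mul, norm_cexp_I_mul_ofReal, one_mul]
  rw [sphereFourier_of_harmonic hd h1 h2, hy] at hb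
  simp only [norm_mul, norm_pow, Complex.norm_I, one_pow, one_mul, Complex.norm_real,
    norm_norm] at hb
  rw [le_div_iff₀ (norm_pos_iff.2 (fourierConst_ne_zero d))]
  rw [Real.norm_eq_abs] at hb
  linarith

theorem exists_pow_mul_besselSeries_le_of_le (hd : 3 ≤ d) {m p : ℕ} (hp : p ≤ m) :
    ∃ B, ∀ t : ℝ, 0 ≤ t → t ^ p * |besselSeries (alpha d + m) (t ^ 2 / 2)| ≤ B := by
  have hα := alpha_pos hd
  obtain ⟨B₁, h1⟩ := exists_pow_mul_besselSeries_le hd m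
  have hc : ContinuousOn (fun t : ℝ => besselSeries (alpha d + m) (t ^ 2 / 2)) (Icc 0 1) :=
    ((continuous_besselSeries (show 0 < alpha d + m by positivity)).comp
      (by fun_prop)).continuousOn
  obtain ⟨B₂, h2⟩ := isCompact_Icc.exists_bound_of_continuousOn hc
  refine ⟨max B₁ B₂, fun t ht => ?_⟩
  rcases le_total t 1 with h | h
  · refine le_max_of_le_right ((mul_le_of_le_one_left (abs_nonneg _)
      (pow_le_one₀ ht h)).trans (h2 t ⟨ht, h⟩))
  · exact le_max_of_le_left ((mul_le_mul_of_nonneg_right (pow_le_pow_right₀ h hp)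
      (abs_nonneg _)).trans (h1 t ht))

theorem eq_zero_of_evalAt_sphere_eq_zero [NeZero d] {l : ℕ} {P : MvPolynomial (Fin d) ℂ}
    (hP : P.IsHomogeneous l)
    (h : ∀ x : EuclideanSpace ℝ (Fin d), ‖x‖ = 1 → evalAt P x = 0) : P = 0 := by
  have hx (x : EuclideanSpace ℝ (Fin d)) (hx : x ≠ 0) : evalAt P x = 0 := by
    have hx' : ‖x‖ ≠ 0 := norm_ne_zero_iff.2 hx
    rw [← one_smul ℝ x, ← mul_inv_cancel₀ hx', mul_smul, evalAt_smul hP,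
      h _ (by simp [norm_smul, hx']), mul_zero]
  -- Zero is excluded so that every point of the grid is nonzero and can be scaled to the sphere.
  have hinf : (range ((↑) : ℝ → ℂ) \ {0}).Infinite :=
    (infinite_range_of_injective Complex.ofReal_injective).sdiff (finite_singleton _)
  refine funext_set (fun _ => range ((↑) : ℝ → ℂ) \ {0}) (fun _ => hinf) fun z hz => ?_
  choose x hxz using fun i => (hz i trivial).1
  obtain rfl : (fun i => (x i : ℂ)) = z := funext hxz
  rw [map_zero]
  refine hx (WithLp.toLp 2 x) fun h0 => (hz 0 trivial).2 ?_
  have := congrArg (fun v : EuclideanSpace ℝ (Fin d) => v 0) h0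
  simpa using this

/-- Fubini gives integrability along almost every ray. A nonzero `P` cannot vanish almost everywhere
on the sphere, so some such ray has `P(ω) ≠ 0`, and that constant can be divided out. -/
theorem integrableOn_pow_mul_of_integrable (hd : 3 ≤ d) {l : ℕ} {P : MvPolynomial (Fin d) ℂ}
    (hP : P.IsHomogeneous l) (hP0 : P ≠ 0) {f : ℝ → ℂ}
    (hf : Integrable (fun x : EuclideanSpace ℝ (Fin d) => f ‖x‖ * evalAt P x)) :
    IntegrableOn (fun s : ℝ => (s : ℂ) ^ (d - 1 + l) * f s) (Ioi 0) := by
  have : NeZero d := ⟨by omega⟩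
  have : Nonempty (Fin d) := ⟨0⟩
  rw [integrable_polar_iff, finrank_euclideanSpace_fin] at hf
  have hae := hf.prod_right_ae
  have hex : ∃ ω : sphere (0 : EuclideanSpace ℝ (Fin d)) 1, evalAt P ω.1 ≠ 0 ∧
      Integrable (fun r : Ioi (0 : ℝ) => f ‖r.1 • ω.1‖ * evalAt P (r.1 • ω.1))
        (.volumeIoiPow (d - 1)) := by
    by_contra! hcon
    refine hP0 (eq_zero_of_evalAt_sphere_eq_zero hP fun x hx => ?_)
    have h0 : (fun ω : sphere (0 : EuclideanSpace ℝ (Fin d)) 1 => evalAt P ω.1)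
        =ᵐ[(volume : Measure (EuclideanSpace ℝ (Fin d))).toSphere] fun _ => 0 := by
      filter_upwards [hae] with ω hω
      by_contra hne
      exact hcon ω hne hω
    have h1 := (Continuous.ae_eq_iff_eq _ ((continuous_evalAt P).comp continuous_subtype_val)
      continuous_const).1 h0
    exact congrFun h1 ⟨x, by simpa using hx⟩
  obtain ⟨ω, hω, hint⟩ := hex
  have e : (fun r : Ioi (0 : ℝ) => f ‖r.1 • ω.1‖ * evalAt P (r.1 • ω.1)) =
      fun r : Ioi (0 : ℝ) => (fun s : ℝ => f s * ((s : ℂ) ^ l * evalAt P ω.1)) r.1 := by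
    funext r
    have hr : (0 : ℝ) < r.1 := r.2
    have h1 : ‖ω.1‖ = 1 := by simp
    simp only [evalAt_smul hP, norm_smul, h1, mul_one, Real.norm_of_nonneg hr.le]
  rw [e, integrable_volumeIoiPow_iff (d - 1) (fun s : ℝ => f s * ((s : ℂ) ^ l * evalAt P ω.1))]
    at hint
  refine (hint.mul_const (evalAt P ω.1)⁻¹).congr (.of_forall fun s => ?_)
  simp only [Complex.real_smul, Complex.ofReal_pow, pow_add]
  field_simp

theorem fourierT_eq_integral_sphereFourier (hd : 3 ≤ d) {l : ℕ} {P : MvPolynomial (Fin d) ℂ}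
    (hP : P.IsHomogeneous l) {f : ℝ → ℂ}
    (hf : Integrable (fun x : EuclideanSpace ℝ (Fin d) => f ‖x‖ * evalAt P x))
    (y : EuclideanSpace ℝ (Fin d)) :
    fourierT (fun x => f ‖x‖ * evalAt P x) y = (fourierConst d)⁻¹ *
      ∫ s in Ioi (0 : ℝ), (s : ℂ) ^ (d - 1 + l) * f s * sphereFourier P (s • y) := by
  have : Nonempty (Fin d) := ⟨⟨0, by omega⟩⟩
  have hg : Integrable (fun x : EuclideanSpace ℝ (Fin d) =>
      Complex.exp (Complex.I * ((inner ℝ y x : ℝ) : ℂ)) * (f ‖x‖ * evalAt P x)) :=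
    hf.bdd_mul (c := 1) (Continuous.aestronglyMeasurable (by fun_prop))
      (.of_forall fun x => (norm_cexp_I_mul_ofReal _).le)
  have hc : (((2 * Real.pi) ^ (-(d : ℝ) / 2) : ℝ) : ℂ) = (fourierConst d)⁻¹ := by
    rw [fourierConst, neg_div, Real.rpow_neg (by positivity), Complex.ofReal_inv]
  unfold fourierT
  rw [hc, integral_polar]
  rw [integrable_polar_iff] at hg
  rw [integral_prod_symm _ hg, finrank_euclideanSpace_fin]
  have e (r : Ioi (0 : ℝ)) : (∫ ω : sphere (0 : EuclideanSpace ℝ (Fin d)) 1,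
      Complex.exp (Complex.I * ((inner ℝ y (r.1 • ω.1) : ℝ) : ℂ)) *
        (f ‖r.1 • ω.1‖ * evalAt P (r.1 • ω.1))
          ∂(volume : Measure (EuclideanSpace ℝ (Fin d))).toSphere) =
      (fun s : ℝ => (s : ℂ) ^ l * f s * sphereFourier P (s • y)) r.1 := by
    have hr : (0 : ℝ) < r.1 := r.2
    simp only [sphereFourier]
    rw [← integral_const_mul]
    refine integral_congr_ae (.of_forall fun ω => ?_)
    have h1 : ‖ω.1‖ = 1 := by simp
    simp only [evalAt_smul hP, norm_smul, h1, mul_one, Real.norm_of_nonneg hr.le,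
      real_inner_smul_left, real_inner_smul_right]
    ring
  simp only [e]
  rw [integral_volumeIoiPow _ (fun s : ℝ => (s : ℂ) ^ l * f s * sphereFourier P (s • y))]
  simp only [Complex.real_smul, Complex.ofReal_pow, pow_add, mul_assoc]

/-- The constant `2^{-ν} / Γ(ν+1)` in front of the Hankel transform. -/
noncomputable def hankelConst (ν : ℝ) : ℝ := (2 : ℝ) ^ (-ν) / Real.Gamma (ν + 1)

theorem hankelConst_ne_zero {ν : ℝ} (hν : 0 < ν) : hankelConst ν ≠ 0 :=
  div_ne_zero (by positivity) (Real.Gamma_pos_of_pos (by linarith)).ne'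

/-- Covers both formulas: `a = k`, `n = l - 2k` for the harmonic components and `a = 0`, `n = l - k`
for the powers of `Δ`. The exponents of `s` agree because `2n + 2a = 2l - 2k`. -/
theorem hankelConst_mul_hankelIntegrand (hd : 3 ≤ d) {l k n a : ℕ} (hk : 2 * k ≤ l)
    (hn : n + a + k = l) (f : ℝ → ℂ) {t s : ℝ} (ht : 0 ≤ t) (hs : 0 < s) :
    (hankelConst (alpha d + n) : ℂ) *
      hankelIntegrand (alpha d + n) (fun s => (s : ℂ) ^ (2 * a) * f s) t s =
    (s : ℂ) ^ (d - 1 + l) * f s * ((s ^ (l - 2 * k) *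
      besselSeries (alpha d + n) ((s * t) ^ 2 / 2) : ℝ) : ℂ) := by
  have hα := alpha_pos hd
  rw [← sphBessel_eq_besselSeries (show 0 < alpha d + n by positivity) (by positivity),
    hankelIntegrand, hankelConst]
  have e : s ^ (2 * (alpha d + n) + 1) = s ^ (d - 1 + 2 * n) := by
    rw [← Real.rpow_natCast]
    congr 1
    push_cast [Nat.cast_sub (show 1 ≤ d by omega), alpha]
    ring
  rw [e]
  push_cast
  have e2 : (s : ℂ) ^ (d - 1 + l) * (s : ℂ) ^ (l - 2 * k) =
      (s : ℂ) ^ (2 * a) * (s : ℂ) ^ (d - 1 + 2 * n) := by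
    rw [← pow_add, ← pow_add]; congr 1; omega
  linear_combination (-(((2 : ℝ) ^ (-(alpha d + n)) : ℝ) : ℂ) / (Real.Gamma (alpha d + n + 1) : ℂ) *
    f s * (sphBessel (alpha d + n) (s * t) : ℂ)) * e2

/-- The integrand is an integrable function times a bounded one. For `t > 0` boundedness uses `l -
2k ≤ n`, which is `a ≤ k`; at `t = 0` the power `s ^ (l - 2k)` is bounded only if it is trivial. -/
theorem hankelConverges_of_integrableOn (hd : 3 ≤ d) {l k n a : ℕ} (hk : 2 * k ≤ l)
    (hn : n + a + k = l) (ha : a ≤ k) {f : ℝ → ℂ}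
    (hf : IntegrableOn (fun s : ℝ => (s : ℂ) ^ (d - 1 + l) * f s) (Ioi 0)) {t : ℝ} (ht : 0 ≤ t)
    (h0 : t ≠ 0 ∨ l = 2 * k) :
    HankelConverges (alpha d + n) (fun s => (s : ℂ) ^ (2 * a) * f s) t := by
  have hα := alpha_pos hd
  have hν : 0 < alpha d + n := by positivity
  have hbd : ∃ B, ∀ s : ℝ, 0 < s →
      |s ^ (l - 2 * k) * besselSeries (alpha d + n) ((s * t) ^ 2 / 2)| ≤ B := by
    rcases eq_or_ne t 0 with rfl | ht0
    · have hl := h0.resolve_left (fun h => h rfl)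
      exact ⟨|besselSeries (alpha d + n) 0|, fun s _ => by simp [hl]⟩
    · obtain ⟨B, hB⟩ := exists_pow_mul_besselSeries_le_of_le hd (show l - 2 * k ≤ n by omega)
      have htp : 0 < t := lt_of_le_of_ne ht ht0.symm
      refine ⟨B / t ^ (l - 2 * k), fun s hs => ?_⟩
      rw [le_div_iff₀ (by positivity), abs_mul, abs_of_pos (show 0 < s ^ (l - 2 * k) by positivity)]
      have := hB (s * t) (by positivity)
      rw [mul_pow s t (l - 2 * k)] at this
      linarith
  obtain ⟨B, hB⟩ := hbd
  have hcont : Continuous fun s : ℝ => ((s ^ (l - 2 * k) *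
      besselSeries (alpha d + n) ((s * t) ^ 2 / 2) : ℝ) : ℂ) := by
    have := (continuous_besselSeries hν).comp (show Continuous fun s : ℝ => (s * t) ^ 2 / 2 by
      fun_prop)
    exact Complex.continuous_ofReal.comp (Continuous.mul (by fun_prop) this)
  have h1 := hf.mul_bdd (c := B) hcont.aestronglyMeasurable
    ((ae_restrict_mem measurableSet_Ioi).mono fun s hs => by
      rw [Complex.norm_real]; exact hB s hs)
  have h2 := h1.const_mul ((hankelConst (alpha d + n) : ℂ)⁻¹)
  refine IntegrableOn.congr_fun h2 (fun s hs => ?_) measurableSet_Ioi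
  have hc : (hankelConst (alpha d + n) : ℂ) ≠ 0 := by exact_mod_cast hankelConst_ne_zero hν
  rw [← hankelConst_mul_hankelIntegrand hd hk hn f ht hs, inv_mul_cancel_left₀ hc]

theorem fourierT_eq_sum_hankel (hd : 3 ≤ d) {l : ℕ} {P : MvPolynomial (Fin d) ℂ}
    (hP : P.IsHomogeneous l) {f : ℝ → ℂ}
    (hf : Integrable (fun x : EuclideanSpace ℝ (Fin d) => f ‖x‖ * evalAt P x))
    (y : EuclideanSpace ℝ (Fin d)) (S : Finset ℕ) (a q : ℕ → ℂ) (ν : ℕ → ℝ) (φ : ℕ → ℝ → ℂ)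
    (hconv : ∀ k ∈ S, q k ≠ 0 → HankelConverges (ν k) (φ k) ‖y‖)
    (hexp : ∀ s : ℝ, 0 < s → (s : ℂ) ^ (d - 1 + l) * f s * sphereFourier P (s • y) =
      fourierConst d * (Complex.I ^ l * ∑ k ∈ S,
        a k * ((hankelConst (ν k) : ℂ) * hankelIntegrand (ν k) (φ k) ‖y‖ s) * q k)) :
    fourierT (fun x => f ‖x‖ * evalAt P x) y =
      Complex.I ^ l * ∑ k ∈ S, a k * hankel (ν k) (φ k) ‖y‖ * q k := by
  rw [fourierT_eq_integral_sphereFourier hd hP hf,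
    setIntegral_congr_fun measurableSet_Ioi fun s hs => hexp s hs, integral_const_mul,
    inv_mul_cancel_left₀ (fourierConst_ne_zero d), integral_const_mul, integral_finsetSum]
  · congr 1
    refine Finset.sum_congr rfl fun k _ => ?_
    rw [integral_mul_const, integral_const_mul, integral_const_mul]
    rfl
  · intro k hk
    -- A term with zero polynomial factor has zero integrand, so it needs no convergence.
    by_cases hq : q k = 0
    · simp [hq]
    · exact (((hconv k hk hq).const_mul _).const_mul _).mul_const _

end GenBochner

/-! ### Assembly of the two formulas. -/

theorem corollary5 (d : ℕ) (hd : 3 ≤ d) (l : ℕ) (P : MvPolynomial (Fin d) ℂ)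
    (hP : P.IsHomogeneous l) (f : ℝ → ℂ)
    (hf : Integrable (fun x : EuclideanSpace ℝ (Fin d) => f ‖x‖ * evalAt P x)) :
    IsCanonicalDecomposition l P (fun k => harmComp l k P) ∧
    ∀ y : EuclideanSpace ℝ (Fin d),
      (∀ k ≤ l / 2, evalAt (harmComp l k P) y ≠ 0 →
        HankelConverges (alpha d + l - 2 * k) (fun s => (s : ℂ) ^ (2 * k) * f s) ‖y‖) ∧
      (∀ k ≤ l / 2, evalAt (lap^[k] P) y ≠ 0 →
        HankelConverges (alpha d + l - k) f ‖y‖) ∧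
      fourierT (fun x => f ‖x‖ * evalAt P x) y =
        Complex.I ^ l * ∑ k ∈ Finset.range (l / 2 + 1),
          (-1) ^ k * hankel (alpha d + l - 2 * k) (fun s => (s : ℂ) ^ (2 * k) * f s) ‖y‖ *
            evalAt (harmComp l k P) y ∧
      fourierT (fun x => f ‖x‖ * evalAt P x) y =
        Complex.I ^ l * ∑ k ∈ Finset.range (l / 2 + 1),
          (-1) ^ k / (2 ^ k * (k.factorial : ℂ)) * hankel (alpha d + l - k) f ‖y‖ *
            evalAt (lap^[k] P) y := by
  have hdec := isCanonicalDecomposition_harmComp hd hP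
  refine ⟨hdec, fun y => ?_⟩
  have hindex1 (k : ℕ) (hk : k ≤ l / 2) :
      alpha d + l - 2 * k = alpha d + ((l - 2 * k : ℕ) : ℝ) := by
    push_cast [Nat.cast_sub (show 2 * k ≤ l by omega)]; ring
  have hindex2 (k : ℕ) (hk : k ≤ l / 2) :
      alpha d + l - k = alpha d + ((l - k : ℕ) : ℝ) := by
    push_cast [Nat.cast_sub (show k ≤ l by omega)]; ring
  have hf0 : f = fun s : ℝ => (s : ℂ) ^ (2 * 0) * f s := by simp
  -- A homogeneous polynomial that is nonzero at the origin has degree 0, which is the alternative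
  -- needed for convergence at `t = 0`.
  have hzero {Q : MvPolynomial (Fin d) ℂ} {m : ℕ} (hQ : Q.IsHomogeneous m)
      (h : evalAt Q y ≠ 0) : ‖y‖ ≠ 0 ∨ m = 0 := by
    by_contra! hc
    refine h ?_
    rw [norm_eq_zero.1 hc.1, ← zero_smul ℝ (0 : EuclideanSpace ℝ (Fin d)), evalAt_smul hQ]
    simp [hc.2]
  have hconv1 (k : ℕ) (hk : k ≤ l / 2) (h : evalAt (harmComp l k P) y ≠ 0) :
      HankelConverges (alpha d + l - 2 * k) (fun s => (s : ℂ) ^ (2 * k) * f s) ‖y‖ := by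
    have hP0 : P ≠ 0 := by
      rintro rfl
      simp [harmComp, lap_iterate_zero, evalAt_zero] at h
    rw [hindex1 k hk]
    refine hankelConverges_of_integrableOn hd (l := l) (k := k) (by omega) (by omega) le_rfl
      (integrableOn_pow_mul_of_integrable hd hP hP0 hf) (norm_nonneg y) ?_
    exact (hzero (hdec.homogeneous k hk) h).imp_right fun h => by omega
  have hconv2 (k : ℕ) (hk : k ≤ l / 2) (h : evalAt (lap^[k] P) y ≠ 0) :
      HankelConverges (alpha d + l - k) f ‖y‖ := by
    have hP0 : P ≠ 0 := by
      rintro rfl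
      simp [lap_iterate_zero, evalAt_zero] at h
    rw [hindex2 k hk, hf0]
    refine hankelConverges_of_integrableOn hd (l := l) (k := k) (by omega) (by omega) (Nat.zero_le _)
      (integrableOn_pow_mul_of_integrable hd hP hP0 hf) (norm_nonneg y) ?_
    exact (hzero (isHomogeneous_lap_iterate hP k) h).imp_right fun h => by omega
  refine ⟨hconv1, hconv2, ?_, ?_⟩
  · refine fourierT_eq_sum_hankel hd hP hf y _ _ _ _ _
      (fun k hk => hconv1 k (Nat.lt_succ_iff.1 (Finset.mem_range.1 hk))) fun s hs => ?_
    have hS : sphereFourier P (s • y) =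
        ∑ k ∈ Finset.range (l / 2 + 1), sphereFourier (harmComp l k P) (s • y) := by
      conv_lhs => rw [hdec.sum_eq, sphereFourier_sum]
      exact Finset.sum_congr rfl fun k _ => sphereFourier_rSq_pow_mul k _ _
    rw [hS, Finset.mul_sum, Finset.mul_sum, Finset.mul_sum]
    refine Finset.sum_congr rfl fun k hk => ?_
    have hk' : k ≤ l / 2 := Nat.lt_succ_iff.1 (Finset.mem_range.1 hk)
    -- The sign `(-1) ^ k` of the first formula is `i ^ (-2k)`, from the lower degree of the
    -- component.
    have hI : Complex.I ^ (l - 2 * k) = Complex.I ^ l * (-1) ^ k := by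
      conv_rhs => rw [← Nat.sub_add_cancel (show 2 * k ≤ l by omega), pow_add, pow_mul,
        Complex.I_sq, mul_assoc, ← mul_pow]
      simp
    rw [sphereFourier_of_harmonic hd (hdec.homogeneous k hk') (hdec.harmonic k hk'), hI,
      evalAt_smul (hdec.homogeneous k hk'), hindex1 k hk',
      hankelConst_mul_hankelIntegrand hd (l := l) (k := k) (by omega) (by omega) f
        (norm_nonneg y) hs, norm_smul, Real.norm_of_nonneg hs.le]
    push_cast
    ring
  · refine fourierT_eq_sum_hankel hd hP hf y _ _ _ _ _
      (fun k hk => hconv2 k (Nat.lt_succ_iff.1 (Finset.mem_range.1 hk))) fun s hs => ?_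
    -- Terms with `k > l / 2` drop out because `Δ^k P = 0` there.
    rw [sphereFourier_eq hd l P hP, ← Finset.sum_subset
      (Finset.range_mono (show l / 2 + 1 ≤ l + 1 by omega)) fun k _ hk => ?_,
      mul_left_comm, mul_left_comm _ (Complex.I ^ l), Finset.mul_sum]
    · congr 2
      refine Finset.sum_congr rfl fun k hk => ?_
      have hk' : k ≤ l / 2 := Nat.lt_succ_iff.1 (Finset.mem_range.1 hk)
      have key := hankelConst_mul_hankelIntegrand hd (l := l) (k := k) (n := l - k) (a := 0)
        (by omega) (by omega) f (norm_nonneg y) hs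
      rw [← hf0] at key
      rw [hobsonTerm, evalAt_smul (isHomogeneous_lap_iterate hP k), hindex2 k hk', key, norm_smul,
        Real.norm_of_nonneg hs.le]
      push_cast
      ring
    · rw [hobsonTerm, lap_iterate_eq_zero hP (by simp at hk; omega), evalAt_zero, mul_zero]
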